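/- **Conventions.** A *range set* is a set $R\subseteq[0,\infty)$ with $0\in R$; it is *characteristic* if for every $t\in(0,\infty)$ there is $r\in R\setminus\{0\}$ with $r\le t$. The *nearly discrete metric* on $R$ is $M_R(x,y)=\max\{x,y\}$ for $x\ne y$ and $M_R(x,x)=0$. The weight $w(Z)$ of a topological space $Z$ is the least cardinality of an open base of $Z$. A non-empty compact Hausdorff space is *$0$-dimensional* if its clopen subsets form an open base. For a compact Hausdorff space $X$: * $C_0(X,R)$ is the set of all continuous maps $f\colon X\to(R,M_R)$ with $0\in f(X)$, with the metric $\triangledown(f,g)=\inf\{\epsilon\in(0,\infty) : f(x)\le \max\{g(x),\epsilon\}\text{ and }g(x)\le\max\{f(x),\epsilon\}\text{ for all }x\in X\}$; * $\mathrm{Cpm}(X,R)$ is the set of all pseudo-ultrametrics $d\colon X\times X\to R$ that are continuous for the product topology on $X \times X$ and the Euclidean topology on $R$, with the metric $\mathcal{UD}(d,e)=\inf\{\epsilon\in R : d(x,y)\le \max\{e(x,y),\epsilon\}\text{ and }e(x,y)\le\max\{d(x,y),\epsilon\}\text{ for all }x,y\in X\}$. For an infinite cardinal $\tau$, $B(\tau)$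 is the countable power $D^{\mathbb N}$ of a discrete space $D$ of cardinality $\tau$. **Theorem.** Let $\kappa$ be an infinite cardinal, let $X$ be a $0$-dimensional compact Hausdorff space of weight $\kappa$ without isolated points, and let $Y$ be a $0$-dimensional compact Hausdorff space of weight $\kappa$ with an accumulation point (a non-isolated point). Let $R$ be a characteristic range set and put $\tau=\max\{\kappa,\mathrm{card}(R)\}$. Assume that * (a) $\mathrm{card}(R)\le\kappa$, or * (b) $\mathrm{card}(R\cap[0,r])=\mathrm{card}(R)$ for all $r\in R\setminus\{0\}$. Then: 1. $\mathrm{Cpm}(X,R)$ and $\mathrm{Cpm}(Y,R)$ are homeomorphic to $B(\tau)$. 2. $C_0(X,R)$ is homeomorphic to $B(\tau)$, provided that every non-empty clopen subset $G$ of $X$ satisfies $w(G)=\kappa$, or that (b) holds and $\kappa\le\mathrm{card}(R)$. -/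

import Mathlib

open Set Topology TopologicalSpace
open scoped NNReal Cardinal

universe u

noncomputable section

/-- The topological weight: the least cardinality of an open base. -/
def topWeight (X : Type u) [TopologicalSpace X] : Cardinal.{u} :=
  sInf {c | ∃ B : Set (Set X), IsTopologicalBasis B ∧ #B = c}

/-- A nonempty space is `0`-dimensional if its clopen subsets form an open base
(for compact Hausdorff spaces the three classical notions of dimension zero agree). -/
def IsZeroDimensional (X : Type u) [TopologicalSpace X] : Prop :=
  Nonempty X ∧ IsTopologicalBasis {s : Set X | IsClopen s}

/-- The Baire space of weight `τ`: the countable power of a discrete space of cardinality `τ`. -/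
def BaireSpaceOfWeight (τ : Cardinal.{u}) : Type u := ℕ → τ.out

/-- The product topology, every factor being discrete. -/
instance (τ : Cardinal.{u}) : TopologicalSpace (BaireSpaceOfWeight τ) :=
  @Pi.topologicalSpace ℕ (fun _ => τ.out) (fun _ => ⊥)

/-- A range set: a subset of `[0, ∞)` containing `0`. -/
structure RangeSet where
  carrier : Set ℝ≥0
  zero_mem : (0 : ℝ≥0) ∈ carrier

/-- A range set is characteristic if it has arbitrarily small positive elements. -/
def RangeSet.IsCharacteristic (R : RangeSet) : Prop :=
  ∀ t : ℝ≥0, 0 < t → ∃ r ∈ R.carrier, r ≠ 0 ∧ r ≤ t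

/-- Every nontrivial initial segment `R ∩ [0, r]` has the cardinality of `R`. -/
def RangeSet.HasFullInitialSegments (R : RangeSet) : Prop :=
  ∀ r ∈ R.carrier, r ≠ 0 → #(R.carrier ∩ Iic r : Set ℝ≥0) = #R.carrier

/-- The set `R` with the nearly discrete metric. -/
structure NearlyDiscrete (R : RangeSet) where
  val : ℝ≥0
  mem : val ∈ R.carrier

theorem NearlyDiscrete.ext' {R : RangeSet} {x y : NearlyDiscrete R} (h : x.val = y.val) :
    x = y := by
  cases x; cases y; cases h; rfl

open Classical in
/-- The nearly discrete metric: `M(x, y) = max x y` if `x ≠ y`, and `M(x, x) = 0`. -/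
instance (R : RangeSet) : MetricSpace (NearlyDiscrete R) where
  dist x y := if x = y then 0 else ((max x.val y.val : ℝ≥0) : ℝ)
  dist_self x := by simp
  dist_comm x y := by simp only [eq_comm (a := x), max_comm x.val]
  dist_triangle x y z := by
    have hx := x.val.2
    have hy := y.val.2
    have hz := z.val.2
    simp only [NNReal.coe_max]
    by_cases h1 : x = y
    · subst h1; simp
    · by_cases h2 : y = z
      · subst h2; simp
      · rw [if_neg h1, if_neg h2]
        split_ifs
        · positivity
        · refine max_le ?_ ?_
          · have := le_max_left (x.val : ℝ) y.val
            have := le_max_right (y.val : ℝ) z.val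
            linarith!
          · have := le_max_right (x.val : ℝ) y.val
            have := le_max_right (y.val : ℝ) z.val
            linarith!
  eq_of_dist_eq_zero := by
    intro x y h
    by_contra hxy
    rw [if_neg hxy] at h
    have h' : max x.val y.val = 0 := by exact_mod_cast h
    have hx : x.val = 0 := le_antisymm (h' ▸ le_max_left _ _) (zero_le)
    have hy : y.val = 0 := le_antisymm (h' ▸ le_max_right _ _) (zero_le)
    exact hxy (NearlyDiscrete.ext' (hx.trans hy.symm))

theorem NearlyDiscrete.continuous_val (R : RangeSet) :
    Continuous (NearlyDiscrete.val : NearlyDiscrete R → ℝ≥0) := by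
  refine LipschitzWith.continuous (K := 1) (LipschitzWith.of_dist_le_mul fun x y => ?_)
  by_cases h : x = y
  · subst h; simp
  · have e : dist x y = ((max x.val y.val : ℝ≥0) : ℝ) := if_neg h
    have hx := x.val.2
    have hy := y.val.2
    rw [e, NNReal.dist_eq, NNReal.coe_max, NNReal.coe_one, one_mul, abs_le]
    have := le_max_left (x.val : ℝ) y.val
    have := le_max_right (x.val : ℝ) y.val
    constructor <;> linarith!

/-- The infimum of all `ε ∈ T` such that `f ≤ max g ε` and `g ≤ max f ε` pointwise. -/
def maxDist {A : Type u} (T : Set ℝ≥0) (f g : A → ℝ≥0) : ℝ≥0 :=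
  sInf {ε | ε ∈ T ∧ ∀ a, f a ≤ max (g a) ε ∧ g a ≤ max (f a) ε}

section maxDist

variable {A : Type u} {T : Set ℝ≥0} {f g h : A → ℝ≥0}

theorem maxDist_self (hT : ∀ δ : ℝ≥0, 0 < δ → ∃ ε ∈ T, ε < δ) : maxDist T f f = 0 := by
  by_contra hne
  obtain ⟨ε, hε, hlt⟩ := hT _ (pos_iff_ne_zero.2 hne)
  have hle : maxDist T f f ≤ ε :=
    csInf_le (OrderBot.bddBelow _) ⟨hε, fun a => ⟨le_max_left _ _, le_max_left _ _⟩⟩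
  exact absurd hle (not_le.2 hlt)

theorem maxDist_comm : maxDist T f g = maxDist T g f := by
  unfold maxDist
  congr 1
  ext ε
  exact and_congr_right fun _ => forall_congr' fun _ => and_comm

theorem exists_of_maxDist_lt (hb : ∃ ε ∈ T, ∀ a, f a ≤ ε ∧ g a ≤ ε) {c : ℝ≥0}
    (hc : maxDist T f g < c) :
    ∃ ε ∈ T, ε < c ∧ ∀ a, f a ≤ max (g a) ε ∧ g a ≤ max (f a) ε := by
  obtain ⟨ε, hε, hlt⟩ := exists_lt_of_csInf_lt (by
    obtain ⟨e, he, hh⟩ := hb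
    exact ⟨e, he, fun a => ⟨le_max_of_le_right (hh a).1, le_max_of_le_right (hh a).2⟩⟩) hc
  exact ⟨ε, hε.1, hlt, hε.2⟩

theorem maxDist_triangle (hfg : ∃ ε ∈ T, ∀ a, f a ≤ ε ∧ g a ≤ ε)
    (hgh : ∃ ε ∈ T, ∀ a, g a ≤ ε ∧ h a ≤ ε) :
    maxDist T f h ≤ max (maxDist T f g) (maxDist T g h) := by
  refine le_of_forall_gt fun c hc => ?_
  obtain ⟨ε, hε, hεc, h1⟩ := exists_of_maxDist_lt hfg (lt_of_le_of_lt (le_max_left _ _) hc)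
  obtain ⟨δ, hδ, hδc, h2⟩ := exists_of_maxDist_lt hgh (lt_of_le_of_lt (le_max_right _ _) hc)
  refine lt_of_le_of_lt (csInf_le (OrderBot.bddBelow _)
    (show max ε δ ∈ _ from ⟨?_, fun a => ⟨?_, ?_⟩⟩)) (max_lt hεc hδc)
  · rcases max_choice ε δ with e | e <;> rw [e] <;> assumption
  · refine (h1 a).1.trans (max_le ((h2 a).1.trans (max_le_max le_rfl (le_max_right _ _))) ?_)
    exact le_max_of_le_right (le_max_left _ _)
  · refine (h2 a).2.trans (max_le ((h1 a).2.trans (max_le_max le_rfl (le_max_left _ _))) ?_)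
    exact le_max_of_le_right (le_max_right _ _)

theorem eq_of_maxDist_eq_zero (hb : ∃ ε ∈ T, ∀ a, f a ≤ ε ∧ g a ≤ ε)
    (h0 : maxDist T f g = 0) : f = g := by
  have key : ∀ c : ℝ≥0, 0 < c → ∀ a, f a ≤ max (g a) c ∧ g a ≤ max (f a) c := by
    intro c hc a
    obtain ⟨ε, -, hεc, h1⟩ := exists_of_maxDist_lt hb (h0 ▸ hc)
    exact ⟨(h1 a).1.trans (max_le_max le_rfl hεc.le), (h1 a).2.trans (max_le_max le_rfl hεc.le)⟩
  funext a
  refine le_antisymm (le_of_forall_gt fun c hc => ?_) (le_of_forall_gt fun c hc => ?_)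
  all_goals
    obtain ⟨c', h1, h2⟩ := exists_between hc
    have := key c' (lt_of_le_of_lt zero_le h1) a
  · exact lt_of_le_of_lt (this.1.trans (max_le h1.le le_rfl)) h2
  · exact lt_of_le_of_lt (this.2.trans (max_le h1.le le_rfl)) h2

end maxDist

/-- `C₀(X, R)`: the continuous maps from `X` to `R` with the nearly discrete topology
whose image contains `0`. -/
structure CZero (X : Type u) [TopologicalSpace X] (R : RangeSet) where
  toMap : C(X, NearlyDiscrete R)
  zero_mem_range : ∃ x, (toMap x).val = 0

theorem CZero.exists_bound {X : Type u} [TopologicalSpace X] [CompactSpace X] {R : RangeSet}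
    (f g : CZero X R) :
    ∃ ε ∈ Ioi (0 : ℝ≥0), ∀ a, (f.toMap a).val ≤ ε ∧ (g.toMap a).val ≤ ε := by
  have hb : ∀ f : CZero X R, ∃ C : ℝ≥0, ∀ a, (f.toMap a).val ≤ C := fun f => by
    obtain ⟨C, hC⟩ := (isCompact_range
      ((NearlyDiscrete.continuous_val R).comp f.toMap.continuous)).bddAbove
    exact ⟨C, fun a => hC ⟨a, rfl⟩⟩
  obtain ⟨C, hC⟩ := hb f
  obtain ⟨D, hD⟩ := hb g
  refine ⟨max C D + 1, by simp only [mem_Ioi]; positivity, fun a => ⟨?_, ?_⟩⟩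
  · exact ((hC a).trans (le_max_left _ _)).trans le_self_add
  · exact ((hD a).trans (le_max_right _ _)).trans le_self_add

/-- The metric `▽` on `C₀(X, R)`: the infimum of all `ε ∈ (0, ∞)` such that
`f ≤ max g ε` and `g ≤ max f ε` on `X`. -/
instance (X : Type u) [TopologicalSpace X] [CompactSpace X] (R : RangeSet) :
    MetricSpace (CZero X R) where
  dist f g := (maxDist (Ioi 0) (fun x => (f.toMap x).val) (fun x => (g.toMap x).val) : ℝ≥0)
  dist_self f := by
    have h : ∀ δ : ℝ≥0, 0 < δ → ∃ ε ∈ Ioi (0 : ℝ≥0), ε < δ := fun δ hδ => exists_between hδ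
    rw [maxDist_self h, NNReal.coe_zero]
  dist_comm f g := by rw [maxDist_comm]
  dist_triangle f g h := by
    exact_mod_cast (maxDist_triangle (f.exists_bound g) (g.exists_bound h)).trans
      (max_le le_self_add le_add_self)
  eq_of_dist_eq_zero := by
    intro f g h
    have h' := eq_of_maxDist_eq_zero (f.exists_bound g) (by exact_mod_cast h)
    cases f; cases g
    congr 1
    ext x
    exact NearlyDiscrete.ext' (congrFun h' x)

/-- The continuous `R`-valued pseudo-ultrametrics on `X`; continuity refers to the product
topology on `X × X` and the usual topology of the reals. -/
structure ContPseudoUltrametric (X : Type u) [TopologicalSpace X] (R : RangeSet) where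
  toFun : X × X → ℝ≥0
  mem : ∀ x y, toFun (x, y) ∈ R.carrier
  self : ∀ x, toFun (x, x) = 0
  symm : ∀ x y, toFun (x, y) = toFun (y, x)
  strong_triangle : ∀ x y z, toFun (x, y) ≤ max (toFun (x, z)) (toFun (z, y))
  continuous : Continuous toFun

theorem ContPseudoUltrametric.exists_bound {X : Type u} [TopologicalSpace X] [CompactSpace X]
    {R : RangeSet} (d e : ContPseudoUltrametric X R) :
    ∃ ε ∈ R.carrier, ∀ p, d.toFun p ≤ ε ∧ e.toFun p ≤ ε := by
  have hb : ∀ d : ContPseudoUltrametric X R, ∃ C ∈ R.carrier, ∀ p, d.toFun p ≤ C := fun d => by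
    rcases isEmpty_or_nonempty (X × X) with h | h
    · exact ⟨0, R.zero_mem, fun p => h.elim p⟩
    · obtain ⟨q, -, hq⟩ := isCompact_univ.exists_isMaxOn univ_nonempty d.continuous.continuousOn
      exact ⟨d.toFun q, d.mem q.1 q.2, fun p => hq (mem_univ p)⟩
  obtain ⟨C, hCR, hC⟩ := hb d
  obtain ⟨D, hDR, hD⟩ := hb e
  refine ⟨max C D, ?_, fun p => ⟨(hC p).trans (le_max_left _ _), (hD p).trans (le_max_right _ _)⟩⟩
  rcases max_choice C D with h | h <;> rw [h] <;> assumption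

/-- The metric on the space of continuous `R`-valued pseudo-ultrametrics: the infimum of all
`ε ∈ R` such that `d ≤ max e ε` and `e ≤ max d ε` on `X × X`. -/
instance (X : Type u) [TopologicalSpace X] [CompactSpace X] (R : RangeSet) :
    MetricSpace (ContPseudoUltrametric X R) where
  dist d e := (maxDist R.carrier d.toFun e.toFun : ℝ≥0)
  dist_self d := by
    rw [maxDist_self fun δ hδ => ⟨0, R.zero_mem, hδ⟩, NNReal.coe_zero]
  dist_comm d e := by rw [maxDist_comm]
  dist_triangle d e h := by
    exact_mod_cast (maxDist_triangle (d.exists_bound e) (e.exists_bound h)).trans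
      (max_le le_self_add le_add_self)
  eq_of_dist_eq_zero := by
    intro d e h
    have h' := eq_of_maxDist_eq_zero (d.exists_bound e) (by exact_mod_cast h)
    cases d; cases e
    congr 1

end

noncomputable section

/-! Both function spaces embed isometrically, with closed range, in `C(K, NearlyDiscrete R)`, where
`K` is `X` or `X × X`: the two infima that define the metrics equal the sup metric over the nearly
discrete metric. They are therefore complete ultrametric spaces. Truncating small values to `0`
leaves locally constant maps, and counting these gives a dense set of size at most `τ`.

By `nonempty_homeomorph_pi_of_partitions`, such a space is `B(τ)` once every nonempty uniformly open
set splits into exactly `τ` small uniformly open pieces. Density bounds the number of pieces from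
above. The lower bound needs many separated points in every ball. One separation constant may not
suffice: if `card(R)` is a countable supremum of smaller cardinals, each `R ∩ [1/n, r]` may have
fewer than `card(R)` elements. Hence `HasSeparatedFamilies` asks only for families whose sizes sum
to `τ`, and `exists_partition` places the `n`-th family near the `n`-th term of a separated
sequence, using a finer radius there.

Separated points arise by altering a function only where it is at most `ε`. Varying a clopen set at
a fixed height gives `κ` of them (`hasSeparatedSets`); varying the height over a fixed clopen set
gives `card(R)` of them under (b) (`hasSeparatedFamilies_of_labels`). -/

/-- A set is uniformly open if it contains a closed ball of fixed positive radius around each of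
its points. -/
def IsUniformlyOpen {Z : Type*} [MetricSpace Z] (s : Set Z) : Prop :=
  ∃ ρ : ℝ, 0 < ρ ∧ ∀ z ∈ s, Metric.closedBall z ρ ⊆ s

theorem IsUniformlyOpen.isOpen {Z : Type*} [MetricSpace Z] {s : Set Z} (h : IsUniformlyOpen s) :
    IsOpen s := by
  obtain ⟨ρ, hρ, h⟩ := h
  exact Metric.isOpen_iff.2 fun z hz => ⟨ρ, hρ, Metric.ball_subset_closedBall.trans (h z hz)⟩

theorem IsUniformlyOpen.isClosed {Z : Type*} [MetricSpace Z] {s : Set Z} (h : IsUniformlyOpen s) :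
    IsClosed s := by
  obtain ⟨ρ, hρ, h⟩ := h
  refine isClosed_of_closure_subset fun z hz => ?_
  obtain ⟨w, hw, hzw⟩ := Metric.mem_closure_iff.1 hz ρ hρ
  exact h w hw (Metric.mem_closedBall.2 hzw.le)

/-! ### Splitting uniformly open sets in ultrametric spaces. -/

section Ultrametric

variable {Z : Type u} [MetricSpace Z] [IsUltrametricDist Z]

theorem dist_le_of_le_of_le {x y z : Z} {a : ℝ} (h1 : dist x y ≤ a) (h2 : dist y z ≤ a) :
    dist x z ≤ a :=
  (dist_triangle_max x y z).trans (max_le h1 h2)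

theorem isUniformlyOpen_closedBall (x : Z) {r : ℝ} (hr : 0 < r) :
    IsUniformlyOpen (Metric.closedBall x r) :=
  ⟨r, hr, fun _ hz _ hw => dist_le_of_le_of_le (Metric.mem_closedBall.1 hw) hz⟩

/-- The `ε`-balls about the `a n` are disjoint, so a radius can be prescribed on each separately. It
depends on `z` only through the predicate `dist z (a n) ≤ ε` in `n`, which is the same for all
points of an `ε`-ball. Away from every `a n` the default is `ε`. -/
theorem exists_radius {ε : ℝ} (hε : 0 < ε) (a : ℕ → Z) (ha : Pairwise fun m n => ε < dist (a m) (a n))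
    (δ : ℕ → ℝ) (hδ : ∀ n, 0 < δ n) :
    ∃ rad : Z → ℝ, (∀ z, 0 < rad z ∧ rad z ≤ ε) ∧ (∀ z w, dist z w ≤ ε → rad z = rad w) ∧
      ∀ n z, dist z (a n) ≤ ε → rad z < δ n := by
  classical
  let r : (ℕ → Prop) → ℝ := fun p => if h : ∃ n, p n then min ε (δ h.choose / 2) else ε
  refine ⟨fun z => r fun n => dist z (a n) ≤ ε, fun z => ?_, fun z w hzw => ?_, fun n z hz => ?_⟩
  · simp only [r]
    split_ifs with h
    · exact ⟨lt_min hε (half_pos (hδ _)), min_le_left _ _⟩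
    · exact ⟨hε, le_rfl⟩
  · refine congrArg r (funext fun n => ?_)
    exact propext ⟨fun h => dist_le_of_le_of_le (by rwa [dist_comm]) h,
      fun h => dist_le_of_le_of_le hzw h⟩
  · have h : ∃ n, dist z (a n) ≤ ε := ⟨n, hz⟩
    have hn : h.choose = n := by
      by_contra hne
      exact absurd (dist_le_of_le_of_le (by rw [dist_comm]; exact h.choose_spec) hz)
        (not_le.2 (ha hne))
    simp only [r]
    rw [dif_pos h, hn]
    exact (min_le_right _ _).trans_lt (half_lt_self (hδ n))

/-- Every ball contains an infinite uniformly separated sequence. -/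
def HasSeparatedSequences (Z : Type u) [MetricSpace Z] : Prop :=
  ∀ (x : Z) (ε : ℝ), 0 < ε → ∃ δ : ℝ, 0 < δ ∧ ∃ a : ℕ → Z,
    (∀ n, dist (a n) x ≤ ε) ∧ Pairwise fun m n => δ ≤ dist (a m) (a n)

/-- For each radius there is a sequence of cardinals with sum at least `τ`, the `n`-th of which is
the size of a uniformly separated family in every ball of that radius. -/
def HasSeparatedFamilies (Z : Type u) [MetricSpace Z] (τ : Cardinal.{u}) : Prop :=
  ∀ ε : ℝ, 0 < ε → ∃ S : ℕ → Type u, τ ≤ #(Σ n, S n) ∧ ∀ n, ∃ δ : ℝ, 0 < δ ∧ ∀ x : Z,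
    ∃ g : S n → Z, (∀ s, dist (g s) x ≤ ε) ∧ Pairwise fun s t => δ ≤ dist (g s) (g t)

/-- The pieces are the balls of radius `rad z`; as `rad` is constant on `ε`-balls, two of them
coincide or are disjoint. The radii need no common lower bound, because each piece is uniformly open
with its own radius. -/
theorem exists_partition {T : Type u} {D : Set Z} (hD : Dense D)
    (hDτ : #D ≤ #T) (hinf : HasSeparatedSequences Z) (hsep : HasSeparatedFamilies Z #T)
    {s : Set Z} (hs : s.Nonempty) (hso : IsUniformlyOpen s) {η : ℝ} (hη : 0 < η) :
    ∃ f : T → Set Z, (∀ i, (f i).Nonempty ∧ IsUniformlyOpen (f i) ∧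
      ∀ x ∈ f i, ∀ y ∈ f i, dist x y ≤ η) ∧ Pairwise (fun i j => Disjoint (f i) (f j)) ∧
      ⋃ i, f i = s := by
  obtain ⟨x, hx⟩ := hs
  obtain ⟨ρ, hρ, hs⟩ := hso
  obtain ⟨δ₀, hδ₀, a, hax, ha⟩ := hinf x ρ hρ
  -- Below `ρ` the pieces stay in `s`, below `δ₀` the `ε`-balls about the `a n` are disjoint, and
  -- below `η` the pieces are small.
  obtain ⟨ε, hε, hεm⟩ := exists_between (show 0 < min (min ρ δ₀) η by positivity)
  have hερ : ε < ρ := hεm.trans_le ((min_le_left _ _).trans (min_le_left _ _))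
  have hεδ : ε < δ₀ := hεm.trans_le ((min_le_left _ _).trans (min_le_right _ _))
  have hεη : ε < η := hεm.trans_le (min_le_right _ _)
  obtain ⟨S, hSτ, hS⟩ := hsep ε hε
  choose δ hδ hg using hS
  have hasep : Pairwise fun m n => ε < dist (a m) (a n) := fun m n h => hεδ.trans_le (ha h)
  obtain ⟨rad, hrad, hradc, hradδ⟩ := exists_radius hε a hasep δ hδ
  choose g hga hgs using fun n => hg n (a n)
  let F : Z → Set Z := fun z => Metric.closedBall z (rad z)
  have hFmem : ∀ z, z ∈ F z := fun z => Metric.mem_closedBall_self (hrad z).1.le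
  have hFeq : ∀ z w, w ∈ F z → F w = F z := fun z w hw => by
    have : rad w = rad z := hradc _ _ ((Metric.mem_closedBall.1 hw).trans (hrad z).2)
    simp only [F, this]
    exact (IsUltrametricDist.closedBall_eq_of_mem hw).symm
  have hFs : ∀ z ∈ s, F z ⊆ s := fun z hz =>
    (Metric.closedBall_subset_closedBall ((hrad z).2.trans hερ.le)).trans (hs z hz)
  let P : Set (Set Z) := F '' s
  have hP : #P = #T := by
    refine le_antisymm ?_ ?_
    · refine le_trans ?_ hDτ
      have : ∀ p : P, ∃ d : D, (d : Z) ∈ (p : Set Z) := by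
        rintro ⟨_, z, hz, rfl⟩
        obtain ⟨d, hd, hdD⟩ := hD.exists_mem_open
          (isUniformlyOpen_closedBall z (hrad z).1).isOpen ⟨z, hFmem z⟩
        exact ⟨⟨d, hd⟩, hdD⟩
      choose d hd using this
      refine Cardinal.mk_le_of_injective (f := d) ?_
      rintro ⟨_, z, hz, rfl⟩ ⟨_, w, hw, rfl⟩ h
      have h1 := hd ⟨_, z, hz, rfl⟩
      have h2 := hd ⟨_, w, hw, rfl⟩
      rw [← h] at h2
      exact Subtype.ext ((hFeq _ _ h1).symm.trans (hFeq _ _ h2))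
    -- The points `g n t` for fixed `n` lie where `rad < δ n`, so they fall in different pieces; for
    -- different `n` they lie in disjoint `ε`-balls.
    · refine hSτ.trans ?_
      have hgS : ∀ n t, g n t ∈ s := fun n t => hs x hx <| dist_le_of_le_of_le
        ((hga n t).trans hερ.le) (hax n)
      refine Cardinal.mk_le_of_injective
        (f := fun q : Σ n, S n => (⟨F (g q.1 q.2), _, hgS _ _, rfl⟩ : P)) ?_
      rintro ⟨n, t⟩ ⟨m, t'⟩ h
      have h' : F (g n t) = F (g m t') := congrArg Subtype.val h
      have hd : dist (g n t) (g m t') ≤ rad (g m t') := by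
        have := hFmem (g n t)
        rw [h'] at this
        exact this
      obtain rfl : n = m := by
        by_contra hne
        refine absurd (dist_le_of_le_of_le (dist_le_of_le_of_le ?_ (hd.trans (hrad _).2)) (hga m t'))
          (not_le.2 (hasep hne))
        rw [dist_comm]
        exact hga n t
      obtain rfl : t = t' := by
        by_contra hne
        exact absurd (hgs n hne) (not_le.2 (hd.trans_lt (hradδ n _ (hga n t'))))
      rfl
  obtain ⟨e⟩ : Nonempty (T ≃ P) := Cardinal.eq.1 hP.symm
  refine ⟨fun i => e i, fun i => ?_, fun i j hij => ?_, ?_⟩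
  · obtain ⟨z, hz, hzi⟩ := (e i).2
    beta_reduce
    rw [← hzi]
    refine ⟨⟨z, hFmem z⟩, isUniformlyOpen_closedBall z (hrad z).1, fun x hx y hy => ?_⟩
    have hle := (hrad z).2.trans hεη.le
    refine dist_le_of_le_of_le ((Metric.mem_closedBall.1 hx).trans hle) ?_
    rw [dist_comm]
    exact (Metric.mem_closedBall.1 hy).trans hle
  · beta_reduce
    rw [Set.disjoint_left]
    intro w hwi hwj
    refine hij (e.injective (Subtype.ext ?_))
    obtain ⟨z, hz, hzi⟩ := (e i).2
    obtain ⟨z', hz', hzj⟩ := (e j).2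
    rw [← hzi] at hwi ⊢
    rw [← hzj] at hwj ⊢
    exact (hFeq _ _ hwi).symm.trans (hFeq _ _ hwj)
  · ext z
    rw [Set.mem_iUnion]
    constructor
    · rintro ⟨i, hi⟩
      obtain ⟨w, hw, hwi⟩ := (e i).2
      rw [← hwi] at hi
      exact hFs w hw hi
    · intro hz
      refine ⟨e.symm ⟨F z, z, hz, rfl⟩, ?_⟩
      rw [e.apply_symm_apply]
      exact hFmem z

end Ultrametric

/-! ### The homeomorphism with the Baire space. -/

/-- A complete metric space in which nonempty uniformly open sets split into `T`-many small ones is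
homeomorphic to the countable power of the discrete space `T`. -/
theorem nonempty_homeomorph_pi_of_partitions {Z T : Type*} [MetricSpace Z] [CompleteSpace Z]
    [Nonempty Z] [TopologicalSpace T] [DiscreteTopology T]
    (h : ∀ (s : Set Z), s.Nonempty → IsUniformlyOpen s → ∀ η : ℝ, 0 < η →
      ∃ f : T → Set Z, (∀ i, (f i).Nonempty ∧ IsUniformlyOpen (f i) ∧
        ∀ x ∈ f i, ∀ y ∈ f i, dist x y ≤ η) ∧ Pairwise (fun i j => Disjoint (f i) (f j)) ∧
        ⋃ i, f i = s) :
    Nonempty (Z ≃ₜ (ℕ → T)) := by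
  classical
  let N := {s : Set Z // s.Nonempty ∧ IsUniformlyOpen s}
  have h' : ∀ (s : N) (n : ℕ), ∃ f : T → N,
      (∀ i, ∀ x ∈ (f i).1, ∀ y ∈ (f i).1, dist x y ≤ (1 / 2 : ℝ) ^ n) ∧
      Pairwise (fun i j => Disjoint (f i).1 (f j).1) ∧ ⋃ i, (f i).1 = s.1 := fun s n => by
    obtain ⟨f, h1, h2, h3⟩ := h s.1 s.2.1 s.2.2 ((1 / 2 : ℝ) ^ n) (by positivity)
    exact ⟨fun i => ⟨f i, (h1 i).1, (h1 i).2.1⟩, fun i => (h1 i).2.2, h2, h3⟩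
  choose f hfd hfp hfu using h'
  -- The tree of iterated partitions. The latest index is the head of the list, matching
  -- `PiNat.res`.
  let A : List T → N := fun l => l.rec
    (⟨univ, univ_nonempty, 1, one_pos, fun _ _ => subset_univ _⟩) fun i l s => f s l.length i
  have hA : ∀ i l, A (i :: l) = f (A l) l.length i := fun _ _ => rfl
  have hmem : ∀ l z, z ∈ (A l).1 → ∃ i, z ∈ (A (i :: l)).1 := fun l z hz => by
    rw [← hfu (A l) l.length, Set.mem_iUnion] at hz
    exact hz
  have hsub : ∀ i l, (A (i :: l)).1 ⊆ (A l).1 := fun i l => by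
    rw [← hfu (A l) l.length, hA]
    exact subset_iUnion (fun i => (f (A l) l.length i).1) i
  have hdist : ∀ i l x y, x ∈ (A (i :: l)).1 → y ∈ (A (i :: l)).1 →
      dist x y ≤ (1 / 2 : ℝ) ^ l.length := fun i l x y hx hy => hfd _ _ i x hx y hy
  have hlim : Filter.Tendsto (fun n : ℕ => (1 / 2 : ℝ) ^ n) Filter.atTop (𝓝 0) :=
    tendsto_pow_atTop_nhds_zero_of_lt_one (by norm_num) (by norm_num)
  have hanti : ∀ x : ℕ → T, Antitone fun n => (A (PiNat.res x n)).1 := fun x =>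
    antitone_nat_of_succ_le fun n => hsub _ _
  -- The root is the whole space, with no diameter bound, so the estimate starts at length `n + 1`.
  have hdist' : ∀ (x : ℕ → T) n y z, y ∈ (A (PiNat.res x (n + 1))).1 →
      z ∈ (A (PiNat.res x (n + 1))).1 → dist y z ≤ (1 / 2 : ℝ) ^ n := fun x n y z hy hz => by
    have := hdist _ _ y z hy hz
    rwa [PiNat.res_length] at this
  -- Cantor's intersection argument: the nodes along a branch shrink, and uniformly open sets are
  -- closed.
  have hpt : ∀ x : ℕ → T, ∃ z, ∀ n, z ∈ (A (PiNat.res x n)).1 := fun x => by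
    choose u hu using fun n => (A (PiNat.res x n)).2.1
    have hu' : ∀ n m, n ≤ m → u m ∈ (A (PiNat.res x n)).1 := fun n m hnm => hanti x hnm (hu m)
    have hc : CauchySeq u := by
      refine Metric.cauchySeq_iff'.2 fun ε hε => ?_
      obtain ⟨n, hn⟩ := (hlim.eventually (gt_mem_nhds hε)).exists
      exact ⟨n + 1, fun m hm => (hdist' x n _ _ (hu' _ _ hm) (hu (n + 1))).trans_lt hn⟩
    obtain ⟨z, hz⟩ := cauchySeq_tendsto_of_complete hc
    refine ⟨z, fun n => (A (PiNat.res x n)).2.2.isClosed.mem_of_tendsto hz ?_⟩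
    exact Filter.eventually_atTop.2 ⟨n, hu' n⟩
  choose φ hφ using hpt
  have hres : ∀ (x y : ℕ → T) n z, z ∈ (A (PiNat.res x n)).1 → z ∈ (A (PiNat.res y n)).1 →
      PiNat.res x n = PiNat.res y n := fun x y n z => by
    induction n with
    | zero => simp
    | succ n ih =>
      intro hx hy
      have e := ih (hsub _ _ hx) (hsub _ _ hy)
      rw [PiNat.res_succ] at hx hy ⊢
      rw [PiNat.res_succ]
      rw [← e] at hy ⊢
      congr 1
      by_contra hne
      exact Set.disjoint_left.1 (hfp (A (PiNat.res x n)) (PiNat.res x n).length hne) hx hy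
  have hinj : Function.Injective φ := fun x y hxy => PiNat.res_injective <| by
    funext n
    exact hres x y n (φ x) (hφ x n) (hxy ▸ hφ y n)
  have huniq : ∀ x z, (∀ n, z ∈ (A (PiNat.res x n)).1) → φ x = z := fun x z hz =>
    dist_le_zero.1 <| ge_of_tendsto' hlim fun n => hdist' x n _ _ (hφ x (n + 1)) (hz (n + 1))
  have hsurj : Function.Surjective φ := fun z => by
    have : Nonempty T := ⟨(hmem [] z (mem_univ z)).choose⟩
    choose! c hc using hmem
    -- The branch obtained by always entering the child that contains `z`.
    let b : ℕ → List T := fun n => n.rec [] fun _ l => c l z :: l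
    refine ⟨fun n => c (b n) z, huniq _ _ fun n => ?_⟩
    have hb : PiNat.res (fun n => c (b n) z) n = b n := by
      induction n with
      | zero => rfl
      | succ n ih => rw [PiNat.res_succ, ih]
    rw [hb]
    induction n with
    | zero => exact mem_univ z
    | succ n ih =>
      refine hc _ _ (ih ?_)
      rw [PiNat.res_succ] at hb
      exact (List.cons.inj hb).2
  have hcyl : ∀ (x : ℕ → T) n, {y | PiNat.res y n = PiNat.res x n} ∈ 𝓝 x := fun x n => by
    rw [← PiNat.cylinder_eq_res]
    exact (PiNat.isOpen_cylinder _ x n).mem_nhds (PiNat.self_mem_cylinder x n)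
  have hcont : Continuous φ := continuous_iff_continuousAt.2 fun x => Metric.tendsto_nhds.2
    fun ε hε => by
      obtain ⟨n, hn⟩ := (hlim.eventually (gt_mem_nhds hε)).exists
      filter_upwards [hcyl x (n + 1)] with y hy
      refine (hdist' x n _ _ ?_ (hφ x (n + 1))).trans_lt hn
      have := hφ y (n + 1)
      rwa [show PiNat.res y (n + 1) = _ from hy] at this
  let e : (ℕ → T) ≃ Z := Equiv.ofBijective φ ⟨hinj, hsurj⟩
  refine ⟨(Homeomorph.mk e hcont ?_).symm⟩
  -- The `n`-th coordinate of the inverse is constant on a node of length `n + 1`, which is open.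
  refine continuous_pi fun n => continuous_iff_continuousAt.2 fun z => ?_
  obtain ⟨x, rfl⟩ := e.surjective z
  refine tendsto_nhds_of_eventually_eq ?_
  have ho := (A (PiNat.res x (n + 1))).2.2.isOpen.mem_nhds (hφ x (n + 1))
  filter_upwards [ho] with w hw
  obtain ⟨y, rfl⟩ := e.surjective w
  have := hres y x (n + 1) _ (hφ y (n + 1)) hw
  rw [PiNat.res_succ, PiNat.res_succ] at this
  simpa using (List.cons.inj this).1

theorem nonempty_homeomorph_baireSpaceOfWeight {Z : Type u} [MetricSpace Z] [IsUltrametricDist Z]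
    [CompleteSpace Z] [Nonempty Z] {τ : Cardinal.{u}} {D : Set Z} (hD : Dense D)
    (hDτ : #D ≤ τ) (hinf : HasSeparatedSequences Z) (hsep : HasSeparatedFamilies Z τ) :
    Nonempty (Z ≃ₜ BaireSpaceOfWeight τ) := by
  let _ : TopologicalSpace τ.out := ⊥
  have : DiscreteTopology τ.out := ⟨rfl⟩
  rw [← Cardinal.mk_out τ] at hDτ hsep
  exact nonempty_homeomorph_pi_of_partitions
    fun s hs hso η hη => exists_partition hD hDτ hinf hsep hs hso hη

/-! ### Sources of separated families. -/

/-- Every ball contains a separated set of cardinality at least `τ`, the separation depending only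
on the radius. -/
def HasSeparatedSets (Z : Type u) [MetricSpace Z] (τ : Cardinal.{u}) : Prop :=
  ∀ ε : ℝ≥0, 0 < ε → ∃ δ : ℝ≥0, 0 < δ ∧ ∀ x : Z, ∃ S : Set Z,
    (∀ y ∈ S, dist y x ≤ ε) ∧ (S.Pairwise fun y z => δ ≤ dist y z) ∧ τ ≤ #S

theorem HasSeparatedSets.mono {Z : Type u} [MetricSpace Z] {τ σ : Cardinal.{u}}
    (h : HasSeparatedSets Z τ) (hσ : σ ≤ τ) : HasSeparatedSets Z σ := fun ε hε => by
  obtain ⟨δ, hδ, h⟩ := h ε hε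
  refine ⟨δ, hδ, fun x => ?_⟩
  obtain ⟨S, h1, h2, h3⟩ := h x
  exact ⟨S, h1, h2, hσ.trans h3⟩

theorem HasSeparatedSets.hasSeparatedSequences {Z : Type u} [MetricSpace Z]
    (h : HasSeparatedSets Z ℵ₀) : HasSeparatedSequences Z := fun x ε hε => by
  obtain ⟨δ, hδ, h⟩ := h ⟨ε, hε.le⟩ hε
  obtain ⟨S, h1, h2, h3⟩ := h x
  have : Infinite S := Cardinal.infinite_iff.2 h3
  let a := Infinite.natEmbedding S
  exact ⟨δ, hδ, fun n => a n, fun n => h1 _ (a n).2,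
    fun m n hmn => h2 (a m).2 (a n).2 fun e => hmn (a.injective (Subtype.ext e))⟩

theorem HasSeparatedSets.hasSeparatedFamilies {Z : Type u} [MetricSpace Z] {τ : Cardinal.{u}}
    (h : HasSeparatedSets Z τ) : HasSeparatedFamilies Z τ := fun ε hε => by
  obtain ⟨δ, hδ, h⟩ := h ⟨ε, hε.le⟩ hε
  refine ⟨fun _ => τ.out, ?_, fun _ => ⟨δ, hδ, fun x => ?_⟩⟩
  · refine (Cardinal.mk_out τ).ge.trans ?_
    exact Cardinal.mk_le_of_injective (f := fun t : τ.out => (⟨0, t⟩ : Σ _ : ℕ, τ.out))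
      fun s t hst => eq_of_heq (Sigma.mk.inj hst).2
  · obtain ⟨S, h1, h2, h3⟩ := h x
    rw [← Cardinal.mk_out τ] at h3
    obtain ⟨e⟩ := h3
    exact ⟨fun t => e t, fun t => h1 _ (e t).2,
      fun s t hst => h2 (e s).2 (e t).2 fun h => hst (e.injective (Subtype.ext h))⟩

theorem RangeSet.IsCharacteristic.infinite {R : RangeSet} (hR : R.IsCharacteristic) :
    R.carrier.Infinite := fun hfin => by
  have hfin' : (R.carrier \ {0}).Finite := hfin.subset sdiff_subset
  obtain ⟨r, hr, hr0, -⟩ := hR 1 one_pos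
  obtain ⟨m, hm, hmin⟩ := exists_min_image _ id hfin' ⟨r, hr, hr0⟩
  have hm0 : 0 < m := pos_iff_ne_zero.2 hm.2
  obtain ⟨t, ht0, htm⟩ := exists_between hm0
  obtain ⟨s, hs, hs0, hst⟩ := hR t ht0
  exact absurd (hmin s ⟨hs, hs0⟩) (not_le.2 (hst.trans_lt htm))

/-- The `n`-th family is labelled by `R ∩ [1/(n+1), r]`, where distinct labels force distance at
least `1/(n+1)`. These slices exhaust `R ∩ (0, r]`, which has the cardinality of `R` by `hfull`. -/
theorem hasSeparatedFamilies_of_labels {Z : Type u} [MetricSpace Z] {R : RangeSet}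
    (hR : R.IsCharacteristic) (hfull : R.HasFullInitialSegments)
    (h : ∀ (x : Z) (ε : ℝ≥0), 0 < ε → ∃ g : ℝ≥0 → Z,
      ∀ s ∈ R.carrier, s ≠ 0 → s ≤ ε → dist (g s) x ≤ ε ∧
        ∀ t ∈ R.carrier, t ≠ 0 → t ≤ ε → s ≠ t → s ≤ dist (g s) (g t)) :
    HasSeparatedFamilies Z (Cardinal.lift.{u} #R.carrier) := fun ε hε => by
  obtain ⟨r, hr, hr0, hrε⟩ := hR ⟨ε, hε.le⟩ hε
  have hinf : ℵ₀ ≤ #R.carrier := Cardinal.infinite_iff.1 hR.infinite.to_subtype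
  let S : ℕ → Set ℝ≥0 := fun n => R.carrier ∩ Icc (1 / ((n : ℝ≥0) + 1)) r
  have hpos : ∀ n : ℕ, (0 : ℝ≥0) < 1 / ((n : ℝ≥0) + 1) := fun n => by positivity
  refine ⟨fun n => ULift.{u} (S n), ?_, fun n => ⟨(1 / ((n : ℝ≥0) + 1) : ℝ≥0), hpos n, fun x => ?_⟩⟩
  · have hle : #R.carrier ≤ #(Σ n, S n) := by
      -- The extra point accounts for the label `0`, which lies in no slice; it is absorbed because
      -- `R` is infinite.
      have h1 : #R.carrier ≤ #(Σ n, S n) + 1 := by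
        rw [← hfull r hr hr0, ← Cardinal.mk_option]
        have hn : ∀ s : ℝ≥0, s ≠ 0 → ∃ n : ℕ, 1 / ((n : ℝ≥0) + 1) < s := fun s hs =>
          exists_nat_one_div_lt (pos_iff_ne_zero.2 hs)
        choose! n hn using hn
        classical
        refine Cardinal.mk_le_of_injective (f := fun s : ↥(R.carrier ∩ Iic r) =>
          if hs : s.1 = 0 then none else some ⟨n s.1, s.1, s.2.1, (hn s.1 hs).le, s.2.2⟩) ?_
        intro s t hst
        by_cases hs : s.1 = 0 <;> by_cases ht : t.1 = 0 <;> simp only [hs, ht, dite_true, dite_false,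
          Option.some.injEq, reduceCtorEq, Sigma.mk.injEq] at hst
        · exact Subtype.ext (hs.trans ht.symm)
        · have : ∀ (m m' : ℕ) (p : S m) (q : S m'), m = m' → HEq p q → p.1 = q.1 := by
            rintro m _ p q rfl h
            rw [eq_of_heq h]
          exact Subtype.ext (this _ _ _ _ hst.1 hst.2)
      have h2 : ℵ₀ ≤ #(Σ n, S n) := by
        by_contra hlt
        exact absurd (hinf.trans h1)
          (not_le.2 (Cardinal.add_lt_aleph0 (not_le.1 hlt) Cardinal.one_lt_aleph0))
      rwa [Cardinal.add_one_eq h2] at h1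
    refine (Cardinal.lift_le.{u}.2 hle).trans ?_
    rw [← Cardinal.mk_uLift]
    exact Cardinal.mk_le_of_injective
      (f := fun p : ULift.{u} (Σ n, S n) => (⟨p.down.1, ⟨p.down.2⟩⟩ : Σ n, ULift.{u} (S n)))
      fun p q hpq => by
        obtain ⟨⟨n, s⟩⟩ := p
        obtain ⟨⟨m, t⟩⟩ := q
        simp only [Sigma.mk.injEq] at hpq
        obtain ⟨rfl, hpq⟩ := hpq
        simpa using hpq
  · obtain ⟨g, hg⟩ := h x ⟨ε, hε.le⟩ hε
    have h0 : ∀ s : S n, s.1 ≠ 0 := fun s => (pos_iff_ne_zero.1 ((hpos n).trans_le s.2.2.1))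
    have hle : ∀ s : S n, s.1 ≤ ⟨ε, hε.le⟩ := fun s => s.2.2.2.trans hrε
    refine ⟨fun s => g s.down, fun s => (hg _ s.down.2.1 (h0 _) (hle _)).1, fun s t hst => ?_⟩
    refine le_trans (NNReal.coe_le_coe.2 s.down.2.2.1)
      ((hg _ s.down.2.1 (h0 _) (hle _)).2 _ t.down.2.1 (h0 _) (hle _) fun e => hst ?_)
    exact ULift.ext _ _ (Subtype.ext e)

/-! ### Geometry of the nearly discrete metric. -/

section NearlyDiscrete

variable {R : RangeSet}

instance : Zero (NearlyDiscrete R) := ⟨⟨0, R.zero_mem⟩⟩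

theorem NearlyDiscrete.val_zero : (0 : NearlyDiscrete R).val = 0 := rfl

theorem NearlyDiscrete.nndist_of_ne {x y : NearlyDiscrete R} (h : x ≠ y) :
    nndist x y = max x.val y.val :=
  NNReal.coe_injective (by rw [coe_nndist]; exact if_neg h)

theorem NearlyDiscrete.nndist_zero (x : NearlyDiscrete R) : nndist x 0 = x.val := by
  by_cases h : x = 0
  · rw [h, nndist_self, val_zero]
  · rw [nndist_of_ne h, val_zero, max_eq_left zero_le]

/-- For distinct values the two inequalities cannot both hold through the first term of the maximum,
and this forces both values below `ε`. This translates the defining conditions of both metrics into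
distances. -/
theorem NearlyDiscrete.nndist_le_iff {x y : NearlyDiscrete R} {ε : ℝ≥0} :
    nndist x y ≤ ε ↔ x.val ≤ max y.val ε ∧ y.val ≤ max x.val ε := by
  by_cases h : x = y
  · simp [h]
  · have hne : x.val ≠ y.val := fun e => h (NearlyDiscrete.ext' e)
    rw [nndist_of_ne h]
    refine ⟨fun hm => ⟨le_max_of_le_right ((le_max_left _ _).trans hm),
      le_max_of_le_right ((le_max_right _ _).trans hm)⟩, fun ⟨h1, h2⟩ => ?_⟩
    rw [le_max_iff] at h1 h2
    rcases h1 with h1 | h1 <;> rcases h2 with h2 | h2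
    · exact absurd (le_antisymm h1 h2) hne
    · exact max_le (h1.trans h2) h2
    · exact max_le h1 (h2.trans h1)
    · exact max_le h1 h2

theorem NearlyDiscrete.nndist_mem (x y : NearlyDiscrete R) : nndist x y ∈ R.carrier := by
  by_cases h : x = y
  · rw [h, nndist_self]; exact R.zero_mem
  · rw [nndist_of_ne h]
    rcases max_choice x.val y.val with e | e <;> rw [e]
    exacts [x.mem, y.mem]

theorem NearlyDiscrete.eq_of_nndist_lt {x y : NearlyDiscrete R} (h : nndist x y < x.val) :
    x = y := by
  by_contra hne
  rw [nndist_of_ne hne] at h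
  exact absurd (le_max_left _ _) (not_le.2 h)

instance : IsUltrametricDist (NearlyDiscrete R) where
  dist_triangle_max x y z := by
    simp only [← coe_nndist]
    norm_cast
    rw [NearlyDiscrete.nndist_le_iff]
    obtain ⟨h1, h2⟩ := NearlyDiscrete.nndist_le_iff.1 (le_refl (nndist x y))
    obtain ⟨h3, h4⟩ := NearlyDiscrete.nndist_le_iff.1 (le_refl (nndist y z))
    rw [le_max_iff] at *
    simp only [le_max_iff] at *
    grind

instance : CompleteSpace (NearlyDiscrete R) := by
  refine Metric.complete_of_cauchySeq_tendsto fun u hu => ?_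
  -- Either the values tend to `0`, or some value recurs above a fixed `ε`; in the latter case the
  -- Cauchy condition makes the sequence eventually constant.
  by_cases h : ∀ ε : ℝ≥0, 0 < ε → ∀ᶠ n in Filter.atTop, (u n).val < ε
  · refine ⟨0, Metric.tendsto_nhds.2 fun ε hε => ?_⟩
    filter_upwards [h ⟨ε, hε.le⟩ hε] with n hn
    rw [← coe_nndist, NearlyDiscrete.nndist_zero]
    exact hn
  · push Not at h
    obtain ⟨ε, hε, h⟩ := h
    obtain ⟨N, hN⟩ := Metric.cauchySeq_iff.1 hu ε hε
    obtain ⟨n, hnN, hn⟩ := Filter.frequently_atTop.1 h N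
    refine ⟨u n, tendsto_nhds_of_eventually_eq (Filter.eventually_atTop.2 ⟨N, fun m hm => ?_⟩)⟩
    exact (NearlyDiscrete.eq_of_nndist_lt (lt_of_lt_of_le (hN n hnN m hm) hn)).symm

/-- The points of norm at most `δ` are sent to zero. -/
def NearlyDiscrete.trunc (δ : ℝ≥0) (x : NearlyDiscrete R) : NearlyDiscrete R :=
  open Classical in if x.val ≤ δ then 0 else x

/-- The fibres of truncation are the closed `δ`-balls, so truncation is locally constant and maps
with equal truncations are `δ`-close. -/
theorem NearlyDiscrete.trunc_eq_trunc_iff {δ : ℝ≥0} {x y : NearlyDiscrete R} :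
    trunc δ x = trunc δ y ↔ nndist x y ≤ δ := by
  unfold trunc
  by_cases h : x = y
  · simp [h]
  · have hx : ∀ z : NearlyDiscrete R, ¬ z.val ≤ δ → z ≠ 0 := fun z hz e => hz (by simp [e, val_zero])
    rw [nndist_of_ne h]
    split_ifs with h1 h2 h2
    · simp [h1, h2]
    · simp [h2, (hx y h2).symm]
    · simp [h1, hx x h1]
    · simp [h, h1]

theorem NearlyDiscrete.isLocallyConstant_trunc {δ : ℝ≥0} (hδ : 0 < δ) :
    IsLocallyConstant (trunc δ : NearlyDiscrete R → NearlyDiscrete R) :=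
  (IsLocallyConstant.iff_eventually_eq _).2 fun x => by
    filter_upwards [Metric.closedBall_mem_nhds x (NNReal.coe_pos.2 hδ)] with y hy
    exact trunc_eq_trunc_iff.2 hy

end NearlyDiscrete

/-! ### The ambient space of continuous maps and its density. -/

section ContinuousMap

variable {K : Type u} [TopologicalSpace K] [CompactSpace K] {R : RangeSet}

theorem nndist_le_iff_forall {f g : C(K, NearlyDiscrete R)} {ε : ℝ≥0} :
    nndist f g ≤ ε ↔ ∀ a, nndist (f a) (g a) ≤ ε :=
  ContinuousMap.dist_le ε.2

/-- Only elements of `T` at or just above the distance matter. The condition holds for `(0, ∞)` by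
density of the order, and for `R` because the distance itself lies in `R`. -/
theorem maxDist_eq_nndist {T : Set ℝ≥0} (f g : C(K, NearlyDiscrete R))
    (hT : ∀ c, nndist f g < c → ∃ ε ∈ T, nndist f g ≤ ε ∧ ε < c) :
    maxDist T (fun a => (f a).val) (fun a => (g a).val) = nndist f g := by
  have key : ∀ ε, (∀ a, (f a).val ≤ max (g a).val ε ∧ (g a).val ≤ max (f a).val ε) ↔
      nndist f g ≤ ε := fun ε => by
    rw [nndist_le_iff_forall]
    exact forall_congr' fun a => NearlyDiscrete.nndist_le_iff.symm
  unfold maxDist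
  simp only [key]
  refine le_antisymm (le_of_forall_gt fun c hc => ?_) (le_csInf ?_ fun ε hε => hε.2)
  · obtain ⟨ε, hε, h1, h2⟩ := hT c hc
    exact (csInf_le (OrderBot.bddBelow _)
      (show ε ∈ {ε | ε ∈ T ∧ nndist f g ≤ ε} from ⟨hε, h1⟩)).trans_lt h2
  · obtain ⟨ε, hε, h1, h2⟩ := hT _ (lt_add_one _)
    exact ⟨ε, hε, h1⟩

theorem nndist_mem_carrier (f g : C(K, NearlyDiscrete R)) : nndist f g ∈ R.carrier := by
  rcases isEmpty_or_nonempty K with h | h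
  · rw [Subsingleton.elim f g, nndist_self]; exact R.zero_mem
  · obtain ⟨a, -, ha⟩ := isCompact_univ.exists_isMaxOn univ_nonempty
      (f.continuous.nndist g.continuous).continuousOn
    have : nndist f g = nndist (f a) (g a) :=
      le_antisymm (nndist_le_iff_forall.2 fun b => ha (mem_univ b))
        (ContinuousMap.dist_apply_le_dist a)
    rw [this]
    exact NearlyDiscrete.nndist_mem _ _

/-- By compactness the range is finite, so the map is encoded by the finite set of its values paired
with their clopen fibres. -/
theorem mk_locallyConstant_le {A : Type u} {τ : Cardinal.{u}} (hτ : ℵ₀ ≤ τ)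
    (hK : #(Clopens K) ≤ τ) (hA : #A ≤ τ) : #(LocallyConstant K A) ≤ τ := by
  classical
  let F : LocallyConstant K A → Finset (A × Clopens K) := fun f =>
    f.range_finite.toFinset.image fun a => (a, ⟨f ⁻¹' {a}, f.isLocallyConstant.isClopen_fiber a⟩)
  have hF : Function.Injective F := fun f g h => by
    ext x
    have hx : (f x, ⟨f ⁻¹' {f x}, f.isLocallyConstant.isClopen_fiber (f x)⟩) ∈ F f :=
      Finset.mem_image_of_mem _ (by simp)
    rw [h] at hx
    obtain ⟨a, -, ha⟩ := Finset.mem_image.1 hx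
    rw [Prod.mk.injEq] at ha
    have h2 : g ⁻¹' {a} = f ⁻¹' {f x} := congrArg (fun U : Clopens K => (U : Set K)) ha.2
    have h3 : x ∈ g ⁻¹' {a} := by rw [h2]; rfl
    exact ha.1.symm.trans h3.symm
  refine (Cardinal.mk_le_of_injective hF).trans ?_
  have hprod : #(A × Clopens K) ≤ τ := by
    rw [Cardinal.mk_prod, Cardinal.lift_id, Cardinal.lift_id]
    exact (mul_le_mul' hA hK).trans (Cardinal.mul_eq_self hτ).le
  rcases finite_or_infinite (A × Clopens K) with h | h
  · exact (Cardinal.lt_aleph0_of_finite _).le.trans hτ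
  · rwa [Cardinal.mk_finset_of_infinite]

/-- One representative for each value of `φ` at every scale `1/(n+1)` gives at most `ℵ₀ · τ = τ`
points. -/
theorem exists_dense_of_approx {Z : Type u} [MetricSpace Z] {τ : Cardinal.{u}} (hτ : ℵ₀ ≤ τ)
    (h : ∀ δ : ℝ≥0, 0 < δ → ∃ (A : Type u) (φ : Z → A), #A ≤ τ ∧
      ∀ x y, φ x = φ y → dist x y ≤ δ) : ∃ D : Set Z, Dense D ∧ #D ≤ τ := by
  have hpos : ∀ n : ℕ, (0 : ℝ≥0) < 1 / ((n : ℝ≥0) + 1) := fun n => by positivity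
  choose A φ hA hφ using fun n : ℕ => h _ (hpos n)
  choose p hp using fun (n : ℕ) (b : range (φ n)) => b.2
  refine ⟨range fun q : Σ n, range (φ n) => p q.1 q.2, ?_, ?_⟩
  · refine Metric.dense_iff.2 fun x r hr => ?_
    obtain ⟨n, hn⟩ := exists_nat_one_div_lt hr
    refine ⟨_, ?_, ⟨n, φ n x, x, rfl⟩, rfl⟩
    refine lt_of_le_of_lt (hφ n _ _ (hp n _)) ?_
    simpa using hn
  · refine Cardinal.mk_range_le.trans ?_
    rw [Cardinal.mk_sigma]
    refine (Cardinal.sum_le_sum _ (fun _ => τ) fun n =>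
      (Cardinal.mk_set_le _).trans (hA n)).trans ?_
    rw [Cardinal.sum_const, Cardinal.mk_nat, Cardinal.lift_uzero, Cardinal.lift_aleph0]
    exact (mul_le_mul' hτ le_rfl).trans (Cardinal.mul_eq_self hτ).le

theorem exists_dense_of_isometry {Z : Type u} [MetricSpace Z] {τ : Cardinal.{u}} (hτ : ℵ₀ ≤ τ)
    (hK : #(Clopens K) ≤ τ) (hR : Cardinal.lift.{u} #R.carrier ≤ τ)
    {ι : Z → C(K, NearlyDiscrete R)} (hι : Isometry ι) : ∃ D : Set Z, Dense D ∧ #D ≤ τ := by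
  refine exists_dense_of_approx hτ fun δ hδ => ?_
  have hU : #(ULift.{u} (NearlyDiscrete R)) ≤ τ := by
    rw [Cardinal.mk_uLift]
    refine (Cardinal.lift_le.2 ?_).trans hR
    exact Cardinal.mk_le_of_injective (f := fun x : NearlyDiscrete R => (⟨x.val, x.mem⟩ : R.carrier))
      fun x y h => NearlyDiscrete.ext' (congrArg Subtype.val h)
  refine ⟨LocallyConstant K (ULift.{u} (NearlyDiscrete R)), fun z =>
    ⟨fun a => ULift.up (NearlyDiscrete.trunc δ (ι z a)),
      ((NearlyDiscrete.isLocallyConstant_trunc hδ).comp_continuous (ι z).continuous).comp _⟩,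
    mk_locallyConstant_le hτ hK hU, fun x y hxy => ?_⟩
  rw [← hι.dist_eq]
  refine nndist_le_iff_forall.2 fun a => NearlyDiscrete.trunc_eq_trunc_iff.1 ?_
  exact congrArg ULift.down (LocallyConstant.congr_fun hxy a)

end ContinuousMap

theorem IsUltrametricDist.of_isometry {Z W : Type*} [MetricSpace Z] [MetricSpace W]
    [IsUltrametricDist W] {ι : Z → W} (hι : Isometry ι) : IsUltrametricDist Z where
  dist_triangle_max x y z := by
    simp only [← hι.dist_eq]
    exact dist_triangle_max _ _ _

theorem nonempty_homeomorph_of_isometry {K : Type u} [TopologicalSpace K] [CompactSpace K]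
    {R : RangeSet} {Z : Type u} [MetricSpace Z] [Nonempty Z] {τ : Cardinal.{u}} (hτ : ℵ₀ ≤ τ)
    (hK : #(Clopens K) ≤ τ) (hR : Cardinal.lift.{u} #R.carrier ≤ τ)
    {ι : Z → C(K, NearlyDiscrete R)} (hι : Isometry ι) (hc : IsClosed (range ι))
    (hinf : HasSeparatedSets Z ℵ₀) (hsep : HasSeparatedFamilies Z τ) :
    Nonempty (Z ≃ₜ BaireSpaceOfWeight τ) := by
  have := IsUltrametricDist.of_isometry hι
  have : CompleteSpace Z := (completeSpace_iff_isComplete_range hι.isUniformInducing).2 hc.isComplete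
  obtain ⟨D, hD, hDτ⟩ := exists_dense_of_isometry hτ hK hR hι
  exact nonempty_homeomorph_baireSpaceOfWeight hD hDτ hinf.hasSeparatedSequences hsep

/-! ### Clopen sets and weight. -/

section Clopens

/-- A clopen set is compact and open, hence a finite union of basic sets. -/
theorem mk_clopens_le_of_isTopologicalBasis {K : Type u} [TopologicalSpace K] [CompactSpace K]
    {κ : Cardinal.{u}} (hκ : ℵ₀ ≤ κ) {B : Set (Set K)} (hB : IsTopologicalBasis B) (hBκ : #B ≤ κ) :
    #(Clopens K) ≤ κ := by
  have h : ∀ U : Clopens K, ∃ s : Finset B, (U : Set K) = ⋃ i ∈ s, (i : Set K) := fun U => by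
    obtain ⟨s, hs, h⟩ := eq_finite_iUnion_of_isTopologicalBasis_of_isCompact_open
      (fun b : B => (b : Set K)) (by simpa using hB) U U.isClopen.isClosed.isCompact U.isClopen.isOpen
    exact ⟨hs.toFinset, by simpa using h⟩
  choose F hF using h
  refine (Cardinal.mk_le_of_injective (f := F) fun U V h => ?_).trans ?_
  · exact SetLike.coe_injective (by rw [hF U, hF V, h])
  · rcases finite_or_infinite B with h | h
    · exact (Cardinal.lt_aleph0_of_finite _).le.trans hκ
    · rwa [Cardinal.mk_finset_of_infinite]

theorem exists_isTopologicalBasis_mk_eq (K : Type u) [TopologicalSpace K] :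
    ∃ B : Set (Set K), IsTopologicalBasis B ∧ #B = topWeight K :=
  csInf_mem (s := {c | ∃ B : Set (Set K), IsTopologicalBasis B ∧ #B = c})
    ⟨_, _, isTopologicalBasis_opens, rfl⟩

theorem mk_clopens_le {K : Type u} [TopologicalSpace K] [CompactSpace K]
    {κ : Cardinal.{u}} (hκ : ℵ₀ ≤ κ) (hK : topWeight K = κ) : #(Clopens K) ≤ κ := by
  obtain ⟨B, hB, h⟩ := exists_isTopologicalBasis_mk_eq K
  exact mk_clopens_le_of_isTopologicalBasis hκ hB (h.trans hK).le

theorem mk_clopens_prod_le {K : Type u} [TopologicalSpace K] [CompactSpace K]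
    {κ : Cardinal.{u}} (hκ : ℵ₀ ≤ κ) (hK : topWeight K = κ) : #(Clopens (K × K)) ≤ κ := by
  obtain ⟨B, hB, h⟩ := exists_isTopologicalBasis_mk_eq K
  refine mk_clopens_le_of_isTopologicalBasis hκ (hB.prod hB) ?_
  rw [← image_prod]
  refine Cardinal.mk_image_le.trans ?_
  rw [Cardinal.mk_setProd, h, hK]
  exact (Cardinal.mul_eq_self hκ).le

theorem topWeight_le_mk_clopens {K : Type u} [TopologicalSpace K]
    (hK : IsTopologicalBasis {s : Set K | IsClopen s}) : topWeight K ≤ #(Clopens K) := by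
  have h : topWeight K ≤ #{s : Set K | IsClopen s} := csInf_le (OrderBot.bddBelow _)
    (show _ ∈ {c | ∃ B : Set (Set K), IsTopologicalBasis B ∧ #B = c} from ⟨_, hK, rfl⟩)
  refine h.trans ?_
  exact Cardinal.mk_le_of_injective (f := fun s : {s : Set K | IsClopen s} => (⟨s.1, s.2⟩ : Clopens K))
    fun s t h => Subtype.ext (congrArg (fun U : Clopens K => (U : Set K)) h)

theorem isTopologicalBasis_isClopen_subtype {K : Type u} [TopologicalSpace K]
    (hK : IsTopologicalBasis {s : Set K | IsClopen s}) (G : Set K) :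
    IsTopologicalBasis {s : Set G | IsClopen s} := by
  refine IsTopologicalBasis.of_isOpen_of_subset (fun s hs => hs.isOpen)
    (isTopologicalBasis_subtype hK (· ∈ G)) ?_
  rintro _ ⟨s, hs, rfl⟩
  exact IsClopen.preimage hs continuous_subtype_val

theorem exists_isClopen_of_ne {K : Type u} [TopologicalSpace K] [T2Space K]
    (hK : IsTopologicalBasis {s : Set K | IsClopen s}) {a b : K} (h : a ≠ b) :
    ∃ V : Set K, IsClopen V ∧ a ∈ V ∧ b ∉ V := by
  obtain ⟨V, hV, ha, hb⟩ := hK.exists_subset_of_mem_open (show a ∈ ({b}ᶜ : Set K) from h)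
    isOpen_compl_singleton
  exact ⟨V, hV, ha, fun hbV => hb hbV rfl⟩

end Clopens

/-- A point is determined by the clopen sets containing it, so finitely many clopen sets allow only
finitely many points. -/
theorem infinite_clopens {K : Type u} [TopologicalSpace K] [T2Space K] [Infinite K]
    (hK : IsTopologicalBasis {s : Set K | IsClopen s}) : Infinite (Clopens K) := by
  by_contra h
  rw [not_infinite_iff_finite] at h
  refine Infinite.not_finite (α := K) (Finite.of_injective
    (fun x => {V : Clopens K | x ∈ V}) fun a b hab => ?_)
  by_contra hne
  obtain ⟨V, hV, ha, hb⟩ := exists_isClopen_of_ne hK hne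
  have h1 : (⟨V, hV⟩ : Clopens K) ∈ {V : Clopens K | a ∈ V} := ha
  beta_reduce at hab
  rw [hab] at h1
  exact hb h1

theorem infinite_of_forall_not_isOpen_singleton {X : Type u} [TopologicalSpace X] [T2Space X]
    (hX : ∀ x : X, ¬ IsOpen ({x} : Set X)) {G : Set X} (hG : IsOpen G) (hne : G.Nonempty) :
    Infinite G := by
  rw [infinite_coe_iff]
  intro hfin
  obtain ⟨x, hx⟩ := hne
  refine hX x ?_
  have h : ({x} : Set X) = G \ (G \ {x}) := by
    ext y
    simp only [mem_singleton_iff, mem_sdiff, not_and, not_not]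
    exact ⟨fun h => ⟨h ▸ hx, fun _ => h⟩, fun h => h.2 h.1⟩
  rw [h]
  exact hG.sdiff (hfin.subset sdiff_subset).isClosed

theorem Continuous.ite_of_isClopen {A B : Type*} [TopologicalSpace A] [TopologicalSpace B]
    {p : A → Prop} [∀ a, Decidable (p a)] (hp : IsClopen {a | p a}) {f g : A → B}
    (hf : Continuous f) (hg : Continuous g) : Continuous fun a => if p a then f a else g a :=
  hf.if (fun a ha => by rw [hp.frontier_eq] at ha; exact ha.elim) hg

theorem NearlyDiscrete.isClopen_val_le {R : RangeSet} {ε : ℝ≥0} (hε : 0 < ε) :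
    IsClopen {x : NearlyDiscrete R | x.val ≤ ε} := by
  have h : {x : NearlyDiscrete R | x.val ≤ ε} = Metric.closedBall 0 ε := by
    ext x
    rw [Metric.mem_closedBall, ← coe_nndist, NearlyDiscrete.nndist_zero]
    exact NNReal.coe_le_coe.symm
  rw [h]
  exact IsUltrametricDist.isClopen_closedBall _ (NNReal.coe_ne_zero.2 hε.ne')

theorem nndist_apply_le_nndist {K : Type u} [TopologicalSpace K] [CompactSpace K] {R : RangeSet}
    (f g : C(K, NearlyDiscrete R)) (a : K) : nndist (f a) (g a) ≤ nndist f g :=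
  nndist_le_iff_forall.1 le_rfl a

/-! ### The space `C₀(X, R)`. -/

section CZero

variable {X : Type u} [TopologicalSpace X] {R : RangeSet}

theorem CZero.isometry_toMap [CompactSpace X] :
    Isometry (CZero.toMap : CZero X R → C(X, NearlyDiscrete R)) :=
  Isometry.of_dist_eq fun f g => by
    rw [← coe_nndist, ← maxDist_eq_nndist (T := Ioi 0) f.toMap g.toMap]
    · rfl
    · intro c hc
      obtain ⟨ε, h1, h2⟩ := exists_between hc
      exact ⟨ε, lt_of_le_of_lt zero_le h1, h1.le, h2⟩

theorem CZero.isClosed_range_toMap [CompactSpace X] :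
    IsClosed (range (CZero.toMap : CZero X R → C(X, NearlyDiscrete R))) := by
  refine ⟨Metric.isOpen_iff.2 fun f hf => ?_⟩
  have hf0 : ∀ x, (f x).val ≠ 0 := fun x hx => hf ⟨⟨f, x, hx⟩, rfl⟩
  rcases isEmpty_or_nonempty X with hX | hX
  · refine ⟨1, one_pos, ?_⟩
    rintro _ - ⟨g, rfl⟩
    exact hX.elim g.zero_mem_range.choose
  -- A nowhere zero map has a positive minimum, and a map closer than that minimum agrees with it
  -- everywhere.
  · obtain ⟨a, -, ha⟩ := isCompact_univ.exists_isMinOn univ_nonempty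
      ((NearlyDiscrete.continuous_val R).comp f.continuous).continuousOn
    refine ⟨(f a).val, NNReal.coe_pos.2 (pos_iff_ne_zero.2 (hf0 a)), ?_⟩
    rintro _ hg ⟨g, rfl⟩
    obtain ⟨x, hx⟩ := g.zero_mem_range
    rw [Metric.mem_ball'] at hg
    have h1 : nndist (f x) (g.toMap x) < (f a).val :=
      (nndist_apply_le_nndist f g.toMap x).trans_lt (NNReal.coe_lt_coe.1 hg)
    have h2 := NearlyDiscrete.eq_of_nndist_lt (h1.trans_le (ha (mem_univ x)))
    exact hf0 x (h2 ▸ hx)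

open Classical in
/-- The function with value `s` on `V`, value `0` elsewhere on `{f ≤ ε}`, and equal to `f` where
`f > ε`. -/
def CZero.modify (f : CZero X R) {ε : ℝ≥0} (hε : 0 < ε) {V : Set X} (hV : IsClopen V)
    (h : ∃ x ∉ V, (f.toMap x).val ≤ ε) (s : NearlyDiscrete R) : CZero X R where
  toMap := ⟨fun x => if x ∈ V then s else if (f.toMap x).val ≤ ε then 0 else f.toMap x,
    Continuous.ite_of_isClopen (p := (· ∈ V)) hV continuous_const (Continuous.ite_of_isClopen
      ((NearlyDiscrete.isClopen_val_le hε).preimage f.toMap.continuous)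
      continuous_const f.toMap.continuous)⟩
  zero_mem_range := by
    obtain ⟨x, hx, hxε⟩ := h
    refine ⟨x, ?_⟩
    rw [ContinuousMap.coe_mk, if_neg hx, if_pos hxε, NearlyDiscrete.val_zero]

variable (f : CZero X R) {ε : ℝ≥0} (hε : 0 < ε) {V : Set X} (hV : IsClopen V)
  (h : ∃ x ∉ V, (f.toMap x).val ≤ ε)

theorem CZero.modify_of_mem (s : NearlyDiscrete R) {x : X} (hx : x ∈ V) :
    (f.modify hε hV h s).toMap x = s := if_pos hx

theorem CZero.modify_of_notMem (s : NearlyDiscrete R) {x : X} (hx : x ∉ V)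
    (hxε : (f.toMap x).val ≤ ε) : (f.modify hε hV h s).toMap x = 0 :=
  (if_neg hx).trans (if_pos hxε)

theorem CZero.modify_of_lt (s : NearlyDiscrete R) {x : X} (hx : x ∉ V)
    (hxε : ¬ (f.toMap x).val ≤ ε) : (f.modify hε hV h s).toMap x = f.toMap x :=
  (if_neg hx).trans (if_neg hxε)

variable [CompactSpace X]

theorem CZero.nndist_apply_le (f g : CZero X R) (x : X) :
    nndist (f.toMap x) (g.toMap x) ≤ nndist f g := by
  rw [← CZero.isometry_toMap.nndist_eq]
  exact nndist_apply_le_nndist _ _ x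

theorem CZero.nndist_modify_le (hVε : ∀ x ∈ V, (f.toMap x).val ≤ ε) {s : NearlyDiscrete R}
    (hs : s.val ≤ ε) : nndist (f.modify hε hV h s) f ≤ ε := by
  rw [← CZero.isometry_toMap.nndist_eq, nndist_le_iff_forall]
  intro x
  by_cases hx : x ∈ V
  · rw [modify_of_mem _ _ _ _ _ hx, NearlyDiscrete.nndist_le_iff]
    exact ⟨le_max_of_le_right hs, le_max_of_le_right (hVε x hx)⟩
  · by_cases hxε : (f.toMap x).val ≤ ε
    · rwa [modify_of_notMem _ _ _ _ _ hx hxε, nndist_comm, NearlyDiscrete.nndist_zero]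
    · rw [modify_of_lt _ _ _ _ _ hx hxε, nndist_self]
      exact zero_le

/-- On `U = {f ≤ ε}` the map is replaced by `r` on a clopen `W` and by `0` off `W`. Two choices of
`W` differ at a point where one map is `r` and the other `0`. -/
theorem CZero.hasSeparatedSets (hR : R.IsCharacteristic) {κ : Cardinal.{u}} (hκ : ℵ₀ ≤ κ)
    (hG : ∀ G : Set X, IsClopen G → G.Nonempty → κ ≤ #(Clopens G)) :
    HasSeparatedSets (CZero X R) κ := fun ε hε => by
  obtain ⟨r, hr, hr0, hrε⟩ := hR ε hε
  refine ⟨r, pos_iff_ne_zero.2 hr0, fun f => ?_⟩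
  let U : Set X := {x | (f.toMap x).val ≤ ε}
  have hU : IsClopen U := (NearlyDiscrete.isClopen_val_le hε).preimage f.toMap.continuous
  have hUκ := hG U hU (f.zero_mem_range.imp fun x hx => by simp [U, hx])
  -- Excluding all of `U` keeps a zero in the modified map; infinitely many clopen sets remain, so
  -- the cardinality is unchanged.
  let I := ({⊤}ᶜ : Set (Clopens U))
  have hV : ∀ W : I, IsClopen (Subtype.val '' (W.1 : Set U)) := fun W =>
    ⟨hU.isClosed.isClosedEmbedding_subtypeVal.isClosedMap _ W.1.isClopen.isClosed,
      hU.isOpen.isOpenMap_subtype_val _ W.1.isClopen.isOpen⟩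
  have h : ∀ W : I, ∃ x ∉ (Subtype.val '' (W.1 : Set U)), (f.toMap x).val ≤ ε := fun W => by
    by_contra! hcon
    refine W.2 (SetLike.coe_injective (eq_univ_of_forall fun x => ?_))
    by_contra hx
    refine absurd (hcon x.1 ?_) (not_lt.2 x.2)
    rintro ⟨y, hy, hyx⟩
    exact hx (Subtype.ext hyx ▸ hy)
  let g : I → CZero X R := fun W => f.modify hε (hV W) (h W) ⟨r, hr⟩
  have key : ∀ (W W' : I) (x : U), x ∈ W.1 → x ∉ W'.1 → r ≤ nndist (g W) (g W') :=
    fun W W' x hx hx' => by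
    refine le_trans ?_ (CZero.nndist_apply_le _ _ x.1)
    rw [CZero.modify_of_mem _ _ _ _ _ (mem_image_of_mem _ hx),
      CZero.modify_of_notMem _ _ _ _ _ ?_ x.2, NearlyDiscrete.nndist_zero]
    rintro ⟨y, hy, hyx⟩
    exact hx' (Subtype.ext hyx ▸ hy)
  have hsep : ∀ W W' : I, W ≠ W' → r ≤ nndist (g W) (g W') := fun W W' hne => by
    by_contra hlt
    refine hne (Subtype.ext (SetLike.ext fun x => ⟨fun hx => ?_, fun hx => ?_⟩))
    · by_contra hx'
      exact hlt (key W W' x hx hx')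
    · by_contra hx'
      exact hlt (nndist_comm (g W') (g W) ▸ key W' W x hx hx')
  refine ⟨range g, ?_, ?_, ?_⟩
  · rintro _ ⟨W, rfl⟩
    refine CZero.nndist_modify_le _ _ _ _ ?_ hrε
    rintro _ ⟨y, -, rfl⟩
    exact y.2
  · rintro _ ⟨W, rfl⟩ _ ⟨W', rfl⟩ hne
    exact hsep W W' fun e => hne (congrArg g e)
  · have : Infinite (Clopens U) := Cardinal.infinite_iff.2 (hκ.trans hUκ)
    have hI : #I = #(Clopens U) := Cardinal.mk_compl_of_infinite _ (by
      rw [Cardinal.mk_singleton]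
      exact Cardinal.one_lt_aleph0.trans_le (hκ.trans hUκ))
    rw [Cardinal.mk_range_eq, hI]
    · exact hUκ
    · intro W W' hWW
      by_contra hne
      have := hsep W W' hne
      rw [hWW, nndist_self] at this
      exact hr0 (le_zero_iff.1 this)

theorem CZero.hasSeparatedFamilies [T2Space X] (hX : ∀ x : X, ¬ IsOpen ({x} : Set X))
    (hX0 : IsTopologicalBasis {s : Set X | IsClopen s})
    (hR : R.IsCharacteristic) (hfull : R.HasFullInitialSegments) :
    HasSeparatedFamilies (CZero X R) (Cardinal.lift.{u} #R.carrier) := by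
  refine hasSeparatedFamilies_of_labels hR hfull fun f ε hε => ?_
  let U : Set X := {x | (f.toMap x).val ≤ ε}
  have hU : IsClopen U := (NearlyDiscrete.isClopen_val_le hε).preimage f.toMap.continuous
  have := infinite_of_forall_not_isOpen_singleton hX hU.isOpen
    (f.zero_mem_range.imp fun x hx => by simp [U, hx])
  -- The label is read off at `a`, while `b` retains the required zero.
  obtain ⟨a, b, hab⟩ := exists_pair_ne U
  obtain ⟨V, hV, ha, hb⟩ := exists_isClopen_of_ne hX0 (fun e => hab (Subtype.ext e))
  have h : ∃ x ∉ V ∩ U, (f.toMap x).val ≤ ε := ⟨b, fun hbV => hb hbV.1, b.2⟩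
  classical
  refine ⟨fun s => if hs : s ∈ R.carrier then f.modify hε (hV.inter hU) h ⟨s, hs⟩ else f,
    fun s hs hs0 hsε => ⟨?_, fun t ht ht0 htε hst => ?_⟩⟩
  · beta_reduce
    rw [dif_pos hs]
    exact CZero.nndist_modify_le _ _ _ _ (fun x hx => hx.2) hsε
  · beta_reduce
    rw [dif_pos hs, dif_pos ht]
    refine le_trans ?_ (NNReal.coe_le_coe.2 (CZero.nndist_apply_le _ _ a.1))
    have haV : a.1 ∈ V ∩ U := ⟨ha, a.2⟩
    rw [CZero.modify_of_mem _ _ _ _ _ haV, CZero.modify_of_mem _ _ _ _ _ haV,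
      NearlyDiscrete.nndist_of_ne fun e => hst (congrArg NearlyDiscrete.val e)]
    exact NNReal.coe_le_coe.2 (le_max_left _ _)

end CZero

/-! ### The space of continuous pseudo-ultrametrics. -/

section ContPseudoUltrametric

variable {X : Type u} [TopologicalSpace X] {R : RangeSet}

namespace ContPseudoUltrametric

/-- At a zero of `d` the nearly discrete distance to the limit is the value itself, so ordinary
continuity suffices. Where `d > 0`, the strong triangle inequality makes `d` locally constant. -/
theorem continuous_mk (d : ContPseudoUltrametric X R) :
    Continuous fun p : X × X => (⟨d.toFun p, d.mem p.1 p.2⟩ : NearlyDiscrete R) := by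
  refine continuous_iff_continuousAt.2 fun p => ?_
  by_cases hp : d.toFun p = 0
  · refine Metric.tendsto_nhds.2 fun ε hε => ?_
    have h0 : (⟨d.toFun p, d.mem p.1 p.2⟩ : NearlyDiscrete R) = 0 := NearlyDiscrete.ext' hp
    have := d.continuous.tendsto p
    rw [hp] at this
    filter_upwards [this.eventually (gt_mem_nhds (show (0 : ℝ≥0) < ⟨ε, hε.le⟩ from hε))] with q hq
    rw [h0, ← coe_nndist, NearlyDiscrete.nndist_zero]
    exact hq
  · refine tendsto_nhds_of_eventually_eq ?_
    have hpos : 0 < d.toFun p := pos_iff_ne_zero.2 hp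
    have h1 : ∀ᶠ q : X × X in 𝓝 p, d.toFun (p.1, q.1) < d.toFun p :=
      (d.continuous.comp (continuous_const.prodMk continuous_fst)).tendsto p |>.eventually
        (gt_mem_nhds (by simpa [d.self] using hpos))
    have h2 : ∀ᶠ q : X × X in 𝓝 p, d.toFun (p.2, q.2) < d.toFun p :=
      (d.continuous.comp (continuous_const.prodMk continuous_snd)).tendsto p |>.eventually
        (gt_mem_nhds (by simpa [d.self] using hpos))
    filter_upwards [h1, h2] with ⟨x, y⟩ hx hy
    obtain ⟨a, b⟩ := p
    simp only at hx hy
    refine NearlyDiscrete.ext' (le_antisymm ?_ ?_)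
    · refine (d.strong_triangle x y a).trans (max_le ?_ ((d.strong_triangle a y b).trans ?_))
      · rw [d.symm]; exact hx.le
      · exact max_le le_rfl hy.le
    · by_contra hlt
      have hlt' : d.toFun (x, y) < d.toFun (a, b) := not_le.1 hlt
      have h3 := d.strong_triangle a b x
      have h4 := d.strong_triangle x b y
      rw [d.symm y b] at h4
      exact absurd h3 (not_le.2 (max_lt hx (h4.trans_lt (max_lt hlt' hy))))

/-- A continuous pseudo-ultrametric is also continuous for the nearly discrete metric. -/
def toMap (d : ContPseudoUltrametric X R) : C(X × X, NearlyDiscrete R) :=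
  ⟨fun p => ⟨d.toFun p, d.mem p.1 p.2⟩, d.continuous_mk⟩

theorem val_toMap (d : ContPseudoUltrametric X R) (p : X × X) : (d.toMap p).val = d.toFun p := rfl

theorem isometry_toMap [CompactSpace X] :
    Isometry (toMap : ContPseudoUltrametric X R → C(X × X, NearlyDiscrete R)) :=
  Isometry.of_dist_eq fun f g => by
    rw [← coe_nndist, ← maxDist_eq_nndist (T := R.carrier) f.toMap g.toMap]
    · rfl
    · exact fun c hc => ⟨_, nndist_mem_carrier _ _, le_rfl, hc⟩

theorem isClosed_range_toMap [CompactSpace X] :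
    IsClosed (range (toMap : ContPseudoUltrametric X R → C(X × X, NearlyDiscrete R))) := by
  have h : range (toMap : ContPseudoUltrametric X R → C(X × X, NearlyDiscrete R)) =
      {f | ∀ x y z, (f (x, x)).val = 0 ∧ (f (x, y)).val = (f (y, x)).val ∧
        (f (x, y)).val ≤ max (f (x, z)).val (f (z, y)).val} := by
    ext f
    constructor
    · rintro ⟨d, rfl⟩ x y z
      exact ⟨d.self x, d.symm x y, d.strong_triangle x y z⟩
    · intro hf
      exact ⟨⟨fun p => (f p).val, fun x y => (f (x, y)).mem, fun x => (hf x x x).1,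
        fun x y => (hf x y y).2.1, fun x y z => (hf x y z).2.2,
        (NearlyDiscrete.continuous_val R).comp f.continuous⟩, rfl⟩
  have hev : ∀ p : X × X, Continuous fun f : C(X × X, NearlyDiscrete R) => (f p).val :=
    fun p => (NearlyDiscrete.continuous_val R).comp (continuous_eval_const p)
  rw [h]
  simp only [ofPred_forall]
  refine isClosed_iInter fun x => isClosed_iInter fun y => isClosed_iInter fun z => ?_
  exact (isClosed_eq (hev _) continuous_const).and <| (isClosed_eq (hev _) (hev _)).and <|
    isClosed_le (hev _) ((hev _).max (hev _))

theorem isClopen_le (d : ContPseudoUltrametric X R) {ε : ℝ≥0} (hε : 0 < ε) :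
    IsClopen {p | d.toFun p ≤ ε} :=
  (NearlyDiscrete.isClopen_val_le hε).preimage d.continuous_mk

theorem le_of_le_of_le (d : ContPseudoUltrametric X R) {x y z : X} {ε : ℝ≥0}
    (h1 : d.toFun (x, z) ≤ ε) (h2 : d.toFun (z, y) ≤ ε) : d.toFun (x, y) ≤ ε :=
  (d.strong_triangle x y z).trans (max_le h1 h2)

open Classical in
/-- The pseudo-ultrametric with value `s` on pairs separated by the clopen set `V`. -/
def ofClopen {V : Set X} (hV : IsClopen V) {s : ℝ≥0} (hs : s ∈ R.carrier) :
    ContPseudoUltrametric X R where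
  toFun p := if p.1 ∈ V ↔ p.2 ∈ V then 0 else s
  mem x y := by
    split_ifs
    exacts [R.zero_mem, hs]
  self x := if_pos Iff.rfl
  symm x y := by simp only [iff_comm]
  strong_triangle x y z := by
    by_cases hx : x ∈ V <;> by_cases hy : y ∈ V <;> by_cases hz : z ∈ V <;> simp [hx, hy, hz]
  continuous := by
    refine Continuous.ite_of_isClopen ?_ continuous_const continuous_const
    have h1 : IsClopen {p : X × X | p.1 ∈ V} := hV.preimage continuous_fst
    have h2 : IsClopen {p : X × X | p.2 ∈ V} := hV.preimage continuous_snd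
    have h : {p : X × X | p.1 ∈ V ↔ p.2 ∈ V} = ({p | p.1 ∈ V} ∩ {p | p.2 ∈ V}) ∪
        ({p | p.1 ∈ V}ᶜ ∩ {p | p.2 ∈ V}ᶜ) := by
      ext p
      simp only [mem_ofPred_eq, mem_union, mem_inter_iff, mem_compl_iff]
      tauto
    rw [h]
    exact (h1.inter h2).union (h1.compl.inter h2.compl)

open Classical in
/-- The pseudo-ultrametric agreeing with `d` on pairs at `d`-distance larger than `ε`, and with
`p ≤ ε` on all other pairs. -/
def glue (d p : ContPseudoUltrametric X R) {ε : ℝ≥0} (hε : 0 < ε) (hp : ∀ q, p.toFun q ≤ ε) :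
    ContPseudoUltrametric X R where
  toFun q := if d.toFun q ≤ ε then p.toFun q else d.toFun q
  mem x y := by
    split_ifs
    exacts [p.mem x y, d.mem x y]
  self x := by simp [d.self, p.self]
  symm x y := by rw [d.symm, p.symm]
  strong_triangle x y z := by
    by_cases hxz : d.toFun (x, z) ≤ ε <;> by_cases hzy : d.toFun (z, y) ≤ ε
    · rw [if_pos hxz, if_pos hzy, if_pos (d.le_of_le_of_le hxz hzy)]
      exact p.strong_triangle x y z
    -- A side longer than `ε` is left unchanged by gluing and exceeds every value of `p`.
    all_goals
      have h := d.strong_triangle x y z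
      have h' := hp (x, y)
      simp only [hxz, hzy, if_true, if_false]
      simp only [le_max_iff] at h ⊢
      split_ifs with hxy
      · grind
      · grind
  continuous := Continuous.ite_of_isClopen (d.isClopen_le hε) p.continuous d.continuous

variable (d p : ContPseudoUltrametric X R) {ε : ℝ≥0} (hε : 0 < ε) (hp : ∀ q, p.toFun q ≤ ε)

theorem glue_of_le {q : X × X} (hq : d.toFun q ≤ ε) : (d.glue p hε hp).toFun q = p.toFun q :=
  if_pos hq

theorem glue_of_not_le {q : X × X} (hq : ¬ d.toFun q ≤ ε) :
    (d.glue p hε hp).toFun q = d.toFun q :=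
  if_neg hq

theorem ofClopen_of_iff {V : Set X} (hV : IsClopen V) {s : ℝ≥0} (hs : s ∈ R.carrier) {x y : X}
    (h : x ∈ V ↔ y ∈ V) : (ofClopen hV hs).toFun (x, y) = 0 := if_pos h

theorem ofClopen_of_not_iff {V : Set X} (hV : IsClopen V) {s : ℝ≥0} (hs : s ∈ R.carrier) {x y : X}
    (h : ¬ (x ∈ V ↔ y ∈ V)) : (ofClopen hV hs).toFun (x, y) = s := if_neg h

theorem ofClopen_eq_or {V : Set X} (hV : IsClopen V) {s : ℝ≥0} (hs : s ∈ R.carrier) (q : X × X) :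
    (ofClopen hV hs).toFun q = 0 ∨ (ofClopen hV hs).toFun q = s := by
  by_cases h : q.1 ∈ V ↔ q.2 ∈ V
  · exact Or.inl (ofClopen_of_iff hV hs h)
  · exact Or.inr (ofClopen_of_not_iff hV hs h)

theorem ofClopen_le {V : Set X} (hV : IsClopen V) {s : ℝ≥0} (hs : s ∈ R.carrier) (hsε : s ≤ ε)
    (q : X × X) : (ofClopen hV hs).toFun q ≤ ε := by
  rcases ofClopen_eq_or hV hs q with h | h <;> rw [h]
  exacts [zero_le, hsε]

theorem ext_toFun {d e : ContPseudoUltrametric X R} (h : ∀ q, d.toFun q = e.toFun q) : d = e := by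
  cases d; cases e
  congr 1
  exact funext h

variable [CompactSpace X]

theorem max_le_nndist {d e : ContPseudoUltrametric X R} {q : X × X} (h : d.toFun q ≠ e.toFun q) :
    max (d.toFun q) (e.toFun q) ≤ nndist d e := by
  rw [← isometry_toMap.nndist_eq]
  refine le_trans (le_of_eq ?_) (nndist_apply_le_nndist _ _ q)
  exact (NearlyDiscrete.nndist_of_ne (x := d.toMap q) (y := e.toMap q)
    fun e => h (congrArg NearlyDiscrete.val e)).symm

theorem nndist_glue_le : nndist (d.glue p hε hp) d ≤ ε := by
  rw [← isometry_toMap.nndist_eq, nndist_le_iff_forall]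
  intro q
  rw [NearlyDiscrete.nndist_le_iff]
  simp only [val_toMap]
  by_cases hq : d.toFun q ≤ ε
  · rw [glue_of_le _ _ _ _ hq]
    exact ⟨le_max_of_le_right (hp q), le_max_of_le_right hq⟩
  · rw [glue_of_not_le _ _ _ _ hq]
    exact ⟨le_max_left _ _, le_max_left _ _⟩

theorem exists_finite_net (d : ContPseudoUltrametric X R) {ε : ℝ≥0} (hε : 0 < ε) :
    ∃ F : Finset X, ∀ y, ∃ x ∈ F, d.toFun (x, y) ≤ ε := by
  obtain ⟨F, -, hF⟩ := isCompact_univ.elim_nhds_subcover (fun x => {y | d.toFun (x, y) ≤ ε})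
    fun x _ => ((d.isClopen_le hε).isOpen.preimage
      (continuous_const.prodMk continuous_id)).mem_nhds (by simp [d.self])
  refine ⟨F, fun y => ?_⟩
  obtain ⟨x, hx, hxy⟩ := mem_iUnion₂.1 (hF (mem_univ y))
  exact ⟨x, hx, hxy⟩

/-- Different clopen sets may give the same glued metric, but only finitely many do: `V` is
recovered from the metric together with its trace on a finite `ε`-net. Hence the range is as large
as the infinite set of clopens. -/
theorem hasSeparatedSets (hR : R.IsCharacteristic) [Infinite (Clopens X)] :
    HasSeparatedSets (ContPseudoUltrametric X R) #(Clopens X) := fun ε hε => by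
  obtain ⟨r, hr, hr0, hrε⟩ := hR ε hε
  refine ⟨r, pos_iff_ne_zero.2 hr0, fun d => ?_⟩
  let p : Clopens X → ContPseudoUltrametric X R := fun V => ofClopen V.isClopen hr
  have hp : ∀ V q, (p V).toFun q ≤ ε := fun V => ofClopen_le V.isClopen hr hrε
  let g : Clopens X → ContPseudoUltrametric X R := fun V => d.glue (p V) hε (hp V)
  refine ⟨range g, ?_, ?_, ?_⟩
  · rintro _ ⟨V, rfl⟩
    exact nndist_glue_le _ _ _ _
  · rintro _ ⟨V, rfl⟩ _ ⟨W, rfl⟩ hne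
    obtain ⟨q, hq⟩ : ∃ q, (g V).toFun q ≠ (g W).toFun q := by
      by_contra! h
      exact hne (ext_toFun h)
    refine le_trans (NNReal.coe_le_coe.2 ?_) (NNReal.coe_le_coe.2 (max_le_nndist hq))
    by_cases hqε : d.toFun q ≤ ε
    · simp only [g, glue_of_le _ _ _ _ hqε] at hq ⊢
      rcases ofClopen_eq_or V.isClopen hr q with h | h <;>
        rcases ofClopen_eq_or W.isClopen hr q with h' | h' <;>
        simp only [p, h, h', ne_eq, not_true_eq_false] at hq ⊢
      · exact le_max_right _ _
      · exact le_max_left _ _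
    · simp only [g, glue_of_not_le _ _ _ _ hqε, ne_eq, not_true_eq_false] at hq
  · obtain ⟨F, hF⟩ := d.exists_finite_net hε
    let Φ : Clopens X → range g × Set F := fun V => (⟨g V, V, rfl⟩, {x | x.1 ∈ V})
    have hΦ : Function.Injective Φ := fun V W hVW => by
      have h1 : g V = g W := congrArg (fun a => (a.1 : ContPseudoUltrametric X R)) hVW
      have h2 : {x : F | x.1 ∈ V} = {x : F | x.1 ∈ W} := congrArg Prod.snd hVW
      ext y
      obtain ⟨x, hx, hxy⟩ := hF y
      have h3 : x ∈ V ↔ x ∈ W := Set.ext_iff.1 h2 ⟨x, hx⟩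
      have h4 : (p V).toFun (x, y) = (p W).toFun (x, y) := by
        rw [← glue_of_le d (p V) hε (hp V) hxy, ← glue_of_le d (p W) hε (hp W) hxy]
        exact congrArg (fun e : ContPseudoUltrametric X R => e.toFun (x, y)) h1
      -- The glued metric tells whether `y` is on the same side as the net point `x`, whose side is
      -- known from the trace.
      have h5 : (x ∈ V ↔ y ∈ V) ↔ (x ∈ W ↔ y ∈ W) := by
        by_cases hV : x ∈ V ↔ y ∈ V <;> by_cases hW : x ∈ W ↔ y ∈ W
        · simp [hV, hW]
        · exact absurd ((ofClopen_of_iff V.isClopen hr hV).symm.trans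
            (h4.trans (ofClopen_of_not_iff W.isClopen hr hW))).symm hr0
        · exact absurd ((ofClopen_of_not_iff V.isClopen hr hV).symm.trans
            (h4.trans (ofClopen_of_iff W.isClopen hr hW))) hr0
        · simp [hV, hW]
      change y ∈ V ↔ y ∈ W
      tauto
    have hle := Cardinal.mk_le_of_injective hΦ
    have hinf : Infinite (range g) := by
      by_contra hfin
      rw [not_infinite_iff_finite] at hfin
      exact Infinite.not_finite (α := Clopens X) (Finite.of_injective Φ hΦ)
    rw [Cardinal.mk_prod, Cardinal.lift_id, Cardinal.lift_id] at hle
    refine hle.trans ((Cardinal.mul_le_max _ _).trans ?_)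
    have h0 : ℵ₀ ≤ #(range g) := Cardinal.infinite_iff.1 hinf
    exact max_le (max_le le_rfl ((Cardinal.lt_aleph0_of_finite _).le.trans h0)) h0

theorem hasSeparatedFamilies [T2Space X] [Infinite X]
    (hX0 : IsTopologicalBasis {s : Set X | IsClopen s})
    (hR : R.IsCharacteristic) (hfull : R.HasFullInitialSegments) :
    HasSeparatedFamilies (ContPseudoUltrametric X R) (Cardinal.lift.{u} #R.carrier) := by
  refine hasSeparatedFamilies_of_labels hR hfull fun d ε hε => ?_
  obtain ⟨F, hF⟩ := d.exists_finite_net hε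
  choose c hcF hc using hF
  -- By pigeonhole two distinct points share a net point, so they are within `ε` and gluing can give
  -- their distance any label up to `ε`.
  obtain ⟨a, b, hab, habc⟩ := Finite.exists_ne_map_eq_of_infinite
    fun y => (⟨c y, hcF y⟩ : F)
  have habd : d.toFun (a, b) ≤ ε := by
    refine d.le_of_le_of_le (z := c a) ?_ ?_
    · rw [d.symm]; exact hc a
    · rw [show c a = c b from congrArg Subtype.val habc]; exact hc b
  obtain ⟨V, hV, ha, hb⟩ := exists_isClopen_of_ne hX0 hab
  have hiff : ¬ (a ∈ V ↔ b ∈ V) := fun h => hb (h.1 ha)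
  classical
  refine ⟨fun s => if hs : s ∈ R.carrier ∧ s ≤ ε then
      d.glue (ofClopen hV hs.1) hε (ofClopen_le hV hs.1 hs.2) else d,
    fun s hs hs0 hsε => ⟨?_, fun t ht ht0 htε hst => ?_⟩⟩
  · beta_reduce
    rw [dif_pos ⟨hs, hsε⟩]
    exact nndist_glue_le _ _ _ _
  · beta_reduce
    rw [dif_pos ⟨hs, hsε⟩, dif_pos ⟨ht, htε⟩]
    refine le_trans (NNReal.coe_le_coe.2 ?_) (NNReal.coe_le_coe.2 (max_le_nndist (q := (a, b)) ?_))
    · rw [glue_of_le _ _ _ _ habd, ofClopen_of_not_iff hV hs hiff]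
      exact le_max_left _ _
    · rw [glue_of_le _ _ _ _ habd, glue_of_le _ _ _ _ habd, ofClopen_of_not_iff hV hs hiff,
        ofClopen_of_not_iff hV ht hiff]
      exact hst

end ContPseudoUltrametric

end ContPseudoUltrametric

/-! ### Assembling the homeomorphisms. -/

theorem ContPseudoUltrametric.nonempty_homeomorph {κ : Cardinal.{u}} (hκ : ℵ₀ ≤ κ)
    {X : Type u} [TopologicalSpace X] [CompactSpace X] [T2Space X]
    (hX0 : IsZeroDimensional X) (hXw : topWeight X = κ)
    {R : RangeSet} (hR : R.IsCharacteristic)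
    (hcard : Cardinal.lift.{u} #R.carrier ≤ κ ∨ R.HasFullInitialSegments) :
    Nonempty (ContPseudoUltrametric X R ≃ₜ
      BaireSpaceOfWeight (max κ (Cardinal.lift.{u} #R.carrier))) := by
  have hκX : κ ≤ #(Clopens X) := hXw ▸ topWeight_le_mk_clopens hX0.2
  have : Infinite (Clopens X) := Cardinal.infinite_iff.2 (hκ.trans hκX)
  have : Infinite X := by
    by_contra hfin
    rw [not_infinite_iff_finite] at hfin
    exact Infinite.not_finite (α := Clopens X) (Finite.of_injective _ SetLike.coe_injective)
  have hsep := ContPseudoUltrametric.hasSeparatedSets (X := X) hR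
  have : Nonempty (ContPseudoUltrametric X R) := ⟨ofClopen isClopen_univ R.zero_mem⟩
  refine nonempty_homeomorph_of_isometry (hκ.trans (le_max_left _ _))
    ((mk_clopens_prod_le hκ hXw).trans (le_max_left _ _)) (le_max_right _ _)
    ContPseudoUltrametric.isometry_toMap ContPseudoUltrametric.isClosed_range_toMap
    (hsep.mono (hκ.trans hκX)) ?_
  -- Clopen sets supply the families when `κ` is the maximum, labels when `card(R)` is.
  rcases le_total (Cardinal.lift.{u} #R.carrier) κ with hle | hle
  · rw [max_eq_left hle]
    exact (hsep.mono hκX).hasSeparatedFamilies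
  · rcases hcard with hle' | hfull
    · rw [max_eq_left hle']
      exact (hsep.mono hκX).hasSeparatedFamilies
    · rw [max_eq_right hle]
      exact ContPseudoUltrametric.hasSeparatedFamilies hX0.2 hR hfull

theorem CZero.nonempty_homeomorph {κ : Cardinal.{u}} (hκ : ℵ₀ ≤ κ)
    {X : Type u} [TopologicalSpace X] [CompactSpace X] [T2Space X]
    (hX0 : IsZeroDimensional X) (hXw : topWeight X = κ) (hX : ∀ x : X, ¬ IsOpen ({x} : Set X))
    {R : RangeSet} (hR : R.IsCharacteristic)
    (hcard : Cardinal.lift.{u} #R.carrier ≤ κ ∨ R.HasFullInitialSegments)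
    (hG : (∀ G : Set X, IsClopen G → G.Nonempty → topWeight G = κ) ∨
      (κ ≤ Cardinal.lift.{u} #R.carrier ∧ R.HasFullInitialSegments)) :
    Nonempty (CZero X R ≃ₜ BaireSpaceOfWeight (max κ (Cardinal.lift.{u} #R.carrier))) := by
  have : Nonempty (CZero X R) := by
    obtain ⟨x⟩ := hX0.1
    exact ⟨⟨ContinuousMap.const X 0, x, rfl⟩⟩
  refine nonempty_homeomorph_of_isometry (hκ.trans (le_max_left _ _))
    ((mk_clopens_le hκ hXw).trans (le_max_left _ _)) (le_max_right _ _)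
    CZero.isometry_toMap CZero.isClosed_range_toMap
    (CZero.hasSeparatedSets hR le_rfl fun G hGc hGn => ?_) ?_
  -- Infinite separated sets need no weight condition: without isolated points every nonempty clopen
  -- set is infinite and so has infinitely many clopen subsets.
  · have := infinite_of_forall_not_isOpen_singleton hX hGc.isOpen hGn
    exact Cardinal.infinite_iff.1
      (infinite_clopens (isTopologicalBasis_isClopen_subtype hX0.2 G))
  · have hlabels : κ ≤ Cardinal.lift.{u} #R.carrier → R.HasFullInitialSegments →
        HasSeparatedFamilies (CZero X R) (max κ (Cardinal.lift.{u} #R.carrier)) :=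
      fun hle hfull => by
        rw [max_eq_right hle]
        exact CZero.hasSeparatedFamilies hX hX0.2 hR hfull
    rcases hG with hG | ⟨hle, hfull⟩
    · have hκsep : Cardinal.lift.{u} #R.carrier ≤ κ →
          HasSeparatedFamilies (CZero X R) (max κ (Cardinal.lift.{u} #R.carrier)) := fun hle => by
        rw [max_eq_left hle]
        refine (CZero.hasSeparatedSets hR hκ fun G hGc hGn => ?_).hasSeparatedFamilies
        rw [← hG G hGc hGn]
        exact topWeight_le_mk_clopens (isTopologicalBasis_isClopen_subtype hX0.2 G)
      rcases hcard with hle | hfull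
      · exact hκsep hle
      · exact (le_total (Cardinal.lift.{u} #R.carrier) κ).elim hκsep fun hle => hlabels hle hfull
    · exact hlabels hle hfull

end

theorem mainTheorem6 (κ : Cardinal.{u}) (hκ : ℵ₀ ≤ κ)
    (X : Type u) [TopologicalSpace X] [CompactSpace X] [T2Space X]
    (hX0 : IsZeroDimensional X) (hXw : topWeight X = κ)
    (hX : ∀ x : X, ¬ IsOpen ({x} : Set X))
    (Y : Type u) [TopologicalSpace Y] [CompactSpace Y] [T2Space Y]
    (hY0 : IsZeroDimensional Y) (hYw : topWeight Y = κ)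
    (hY : ∃ y : Y, ¬ IsOpen ({y} : Set Y))
    (R : RangeSet) (hR : R.IsCharacteristic)
    (hcard : Cardinal.lift.{u} #R.carrier ≤ κ ∨ R.HasFullInitialSegments)
    (τ : Cardinal.{u}) (hτ : τ = max κ (Cardinal.lift.{u} #R.carrier)) :
    (((∀ G : Set X, IsClopen G → G.Nonempty → topWeight G = κ) ∨
        (κ ≤ Cardinal.lift.{u} #R.carrier ∧ R.HasFullInitialSegments)) →
      Nonempty (CZero X R ≃ₜ BaireSpaceOfWeight τ)) ∧
    Nonempty (ContPseudoUltrametric X R ≃ₜ BaireSpaceOfWeight τ) ∧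
    Nonempty (ContPseudoUltrametric Y R ≃ₜ BaireSpaceOfWeight τ) := by
  subst hτ
  exact ⟨CZero.nonempty_homeomorph hκ hX0 hXw hX hR hcard,
    ContPseudoUltrametric.nonempty_homeomorph hκ hX0 hXw hR hcard,
    ContPseudoUltrametric.nonempty_homeomorph hκ hY0 hYw hR hcard⟩
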